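/- Let $G(m)=\lfloor m^2/12\rfloor+1$ if $m\equiv 3,6,9 \pmod{12}$ or $m=10$, and $G(m)=\lfloor m^2/12\rfloor$ otherwise. A queen on a square of an $n\times n$ board attacks all squares of the row, of the column and of the two diagonals through her square. Theorem. Let $k$ and $n$ be positive integers with $k\le n^2$, and let $m$ be the smallest positive integer with $G(m)\ge k$. Then, among all placements of $k$ queens on distinct squares of an $n\times n$ board, the minimum possible number of squares attacked by at least one of the queens is $$mn+O(k),$$ where the constant implied by $O(k)$ is absolute, i.e. independent of $n$ and $k$. -/

import Mathlib

/-- The function `G`; the division is division of natural numbers, that is `⌊m ^ 2 / 12⌋`. -/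
def G (m : ℕ) : ℕ :=
  if m % 12 = 3 ∨ m % 12 = 6 ∨ m % 12 = 9 ∨ m = 10 then m ^ 2 / 12 + 1 else m ^ 2 / 12

/-- The squares of the `n × n` board, as pairs (column, row). -/
abbrev Square (n : ℕ) : Type := Fin n × Fin n

/-- A queen on `p` attacks `q`: the two squares share a row, a column or a diagonal (of either
orientation). A queen attacks the full row, column and diagonals through her square, her own
square included. Queens standing in between are ignored: a blocked line is continued by the
blocking queen, so blocking does not change which squares a set of queens attacks jointly. -/
def QueenAttacks {n : ℕ} (p q : Square n) : Prop :=
  p.1 = q.1 ∨ p.2 = q.2 ∨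
    ((p.1 : ℕ) : ℤ) + ((p.2 : ℕ) : ℤ) = ((q.1 : ℕ) : ℤ) + ((q.2 : ℕ) : ℤ) ∨
    ((p.1 : ℕ) : ℤ) - ((p.2 : ℕ) : ℤ) = ((q.1 : ℕ) : ℤ) - ((q.2 : ℕ) : ℤ)

open Classical in
/-- The set of squares attacked by at least one of the queens placed on the squares of `Q`. -/
noncomputable def attackedSquares {n : ℕ} (Q : Finset (Square n)) : Finset (Square n) :=
  Finset.univ.filter fun q => ∃ p ∈ Q, QueenAttacks p q

/-- The possible numbers of attacked squares over all placements of `k` queens on (distinct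
squares of) the `n × n` board. -/
def attackCounts (n k : ℕ) : Set ℕ :=
  {a | ∃ Q : Finset (Square n), Q.card = k ∧ (attackedSquares Q).card = a}

/-! Distinct lines of the board meet in at most one square. So, up to an error quadratic in the
number of lines, the number of attacked squares is the total length of the attacked lines. With O(m)
lines this error is O(m²) = O(k).

Lower bound. The diagonal and the antidiagonal of a square have lengths with sum at least n + 1.
Hence, for each threshold t, every queen is on a diagonal of length at least t or on an antidiagonal
of length at least n + 1 - t. If the queens occupy r columns, c rows and s such slanted lines,
`StripCovered.card_le_G` gives k ≤ G (r + c + s), so r + c + s ≥ m. Summing over t = 1, ..., n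
counts each line at most as often as its length, and the total length is at least mn
(`mul_le_card_attackedSquares_add`).

The bound by G comes from peeling rings off the r × c grid. A slanted line meets the boundary of a
rectangle at most twice, so a ring of 2(r + c) - 4 grid points carries at most 2s queens, and
removing it lowers d = r + c - s by 4. This yields 4k ≤ 4rc - d² + 4, while 3(4rc - d²) ≤ (r + c +
s)². Rounding settles most residues. For d ≡ 2 mod 4 a possible excess of one queen remains. If d ≥
6 and r or c is odd, `even_card_of_tight_rings` excludes it: two nested rings attaining the bound
force an even number of columns. Otherwise there is slack in the quadratic form, apart from a few
small cases.

Upper bound. A hexagon in a corner uses about m/3 columns, rows and diagonals each and holds about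
m²/12 queens; its antidiagonals are short and cost only O(m²). The extra queen for m ≡ 6 mod 12
comes from four corner hexagons sharing lines, and for m = 10 from a 3 × 3 grid spread over the
board (`exists_placement`). -/

/-! ### Rings covered by diagonals and antidiagonals -/

/-- The points of `P` on the column `x₀` or the row `y₀` whose diagonal belongs to `D`. -/
def diagEnds (P : Finset (ℤ × ℤ)) (D : Finset ℤ) (x₀ y₀ : ℤ) : Finset (ℤ × ℤ) :=
  P.filter fun p => (p.1 = x₀ ∨ p.2 = y₀) ∧ p.1 - p.2 ∈ D

/-- The points of `P` on the column `x₀` or the row `y₀` whose antidiagonal belongs to `A`. -/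
def antidiagEnds (P : Finset (ℤ × ℤ)) (A : Finset ℤ) (x₀ y₀ : ℤ) : Finset (ℤ × ℤ) :=
  P.filter fun p => (p.1 = x₀ ∨ p.2 = y₀) ∧ p.1 + p.2 ∈ A

theorem mem_diagEnds {P : Finset (ℤ × ℤ)} {D : Finset ℤ} {x₀ y₀ : ℤ} {p : ℤ × ℤ} :
    p ∈ diagEnds P D x₀ y₀ ↔ p ∈ P ∧ (p.1 = x₀ ∨ p.2 = y₀) ∧ p.1 - p.2 ∈ D := by
  simp [diagEnds]

theorem mem_antidiagEnds {P : Finset (ℤ × ℤ)} {A : Finset ℤ} {x₀ y₀ : ℤ} {p : ℤ × ℤ} :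
    p ∈ antidiagEnds P A x₀ y₀ ↔ p ∈ P ∧ (p.1 = x₀ ∨ p.2 = y₀) ∧ p.1 + p.2 ∈ A := by
  simp [antidiagEnds]

/-- All points of `P` lie on the boundary of the rectangle with corners `(x₀, y₀)`, `(x₁, y₁)`, and
on one of the diagonals in `D` or antidiagonals in `A`. -/
structure CoveredRing (P : Finset (ℤ × ℤ)) (D A : Finset ℤ) (x₀ x₁ y₀ y₁ : ℤ) : Prop where
  bounds : ∀ p ∈ P, x₀ ≤ p.1 ∧ p.1 ≤ x₁ ∧ y₀ ≤ p.2 ∧ p.2 ≤ y₁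
  boundary : ∀ p ∈ P, p.1 = x₀ ∨ p.1 = x₁ ∨ p.2 = y₀ ∨ p.2 = y₁
  covered : ∀ p ∈ P, p.1 - p.2 ∈ D ∨ p.1 + p.2 ∈ A

namespace CoveredRing

variable {P : Finset (ℤ × ℤ)} {D A : Finset ℤ} {x₀ x₁ y₀ y₁ : ℤ}

/-- Moving in the direction (1, 1) from the left or bottom side leaves both sides for good, so a
diagonal has only one lower end. The three lemmas that follow are the analogues for the other ends.
-/
theorem injOn_low (h : CoveredRing P D A x₀ x₁ y₀ y₁) :
    Set.InjOn (fun p : ℤ × ℤ => p.1 - p.2) (diagEnds P D x₀ y₀) := by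
  intro p hp q hq hpq
  simp only [Finset.mem_coe, mem_diagEnds] at hp hq hpq
  have := h.bounds p hp.1
  have := h.bounds q hq.1
  exact Prod.ext (by omega) (by omega)

theorem injOn_high (h : CoveredRing P D A x₀ x₁ y₀ y₁) :
    Set.InjOn (fun p : ℤ × ℤ => p.1 - p.2) (diagEnds P D x₁ y₁) := by
  intro p hp q hq hpq
  simp only [Finset.mem_coe, mem_diagEnds] at hp hq hpq
  have := h.bounds p hp.1
  have := h.bounds q hq.1
  exact Prod.ext (by omega) (by omega)

theorem injOn_left (h : CoveredRing P D A x₀ x₁ y₀ y₁) :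
    Set.InjOn (fun p : ℤ × ℤ => p.1 + p.2) (antidiagEnds P A x₀ y₁) := by
  intro p hp q hq hpq
  simp only [Finset.mem_coe, mem_antidiagEnds] at hp hq hpq
  have := h.bounds p hp.1
  have := h.bounds q hq.1
  exact Prod.ext (by omega) (by omega)

theorem injOn_right (h : CoveredRing P D A x₀ x₁ y₀ y₁) :
    Set.InjOn (fun p : ℤ × ℤ => p.1 + p.2) (antidiagEnds P A x₁ y₀) := by
  intro p hp q hq hpq
  simp only [Finset.mem_coe, mem_antidiagEnds] at hp hq hpq
  have := h.bounds p hp.1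
  have := h.bounds q hq.1
  exact Prod.ext (by omega) (by omega)

theorem mapsTo_diag (x y : ℤ) :
    Set.MapsTo (fun p : ℤ × ℤ => p.1 - p.2) (diagEnds P D x y) D := by
  intro p hp
  simp only [Finset.mem_coe, mem_diagEnds] at hp
  exact hp.2.2

theorem mapsTo_antidiag (x y : ℤ) :
    Set.MapsTo (fun p : ℤ × ℤ => p.1 + p.2) (antidiagEnds P A x y) A := by
  intro p hp
  simp only [Finset.mem_coe, mem_antidiagEnds] at hp
  exact hp.2.2

theorem card_low (h : CoveredRing P D A x₀ x₁ y₀ y₁) : (diagEnds P D x₀ y₀).card ≤ D.card :=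
  Finset.card_le_card_of_injOn _ (mapsTo_diag _ _) h.injOn_low

theorem card_high (h : CoveredRing P D A x₀ x₁ y₀ y₁) : (diagEnds P D x₁ y₁).card ≤ D.card :=
  Finset.card_le_card_of_injOn _ (mapsTo_diag _ _) h.injOn_high

theorem card_left (h : CoveredRing P D A x₀ x₁ y₀ y₁) : (antidiagEnds P A x₀ y₁).card ≤ A.card :=
  Finset.card_le_card_of_injOn _ (mapsTo_antidiag _ _) h.injOn_left

theorem card_right (h : CoveredRing P D A x₀ x₁ y₀ y₁) : (antidiagEnds P A x₁ y₀).card ≤ A.card :=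
  Finset.card_le_card_of_injOn _ (mapsTo_antidiag _ _) h.injOn_right

theorem subset_union (h : CoveredRing P D A x₀ x₁ y₀ y₁) :
    P ⊆ (diagEnds P D x₀ y₀ ∪ diagEnds P D x₁ y₁) ∪
      (antidiagEnds P A x₀ y₁ ∪ antidiagEnds P A x₁ y₀) := by
  intro p hp
  simp only [Finset.mem_union, mem_diagEnds, mem_antidiagEnds]
  have := h.boundary p hp
  have := h.covered p hp
  tauto

/-- Each line of the cover has at most two ends, one on each of two complementary pairs of sides. -/
theorem card_le (h : CoveredRing P D A x₀ x₁ y₀ y₁) : P.card ≤ 2 * (D.card + A.card) := by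
  have h1 := Finset.card_le_card h.subset_union
  have h2 := Finset.card_union_le (diagEnds P D x₀ y₀ ∪ diagEnds P D x₁ y₁)
    (antidiagEnds P A x₀ y₁ ∪ antidiagEnds P A x₁ y₀)
  have h3 := Finset.card_union_le (diagEnds P D x₀ y₀) (diagEnds P D x₁ y₁)
  have h4 := Finset.card_union_le (antidiagEnds P A x₀ y₁) (antidiagEnds P A x₁ y₀)
  have := h.card_low
  have := h.card_high
  have := h.card_left
  have := h.card_right
  omega

end CoveredRing

/-- A covered ring in which every line of the cover has two points, all of them distinct. -/
structure TightRing (P : Finset (ℤ × ℤ)) (D A : Finset ℤ) (x₀ x₁ y₀ y₁ : ℤ) : Prop where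
  low : ∀ v ∈ D, ∃ p ∈ P, (p.1 = x₀ ∨ p.2 = y₀) ∧ p.1 - p.2 = v
  high : ∀ v ∈ D, ∃ p ∈ P, (p.1 = x₁ ∨ p.2 = y₁) ∧ p.1 - p.2 = v
  left : ∀ u ∈ A, ∃ p ∈ P, (p.1 = x₀ ∨ p.2 = y₁) ∧ p.1 + p.2 = u
  right : ∀ u ∈ A, ∃ p ∈ P, (p.1 = x₁ ∨ p.2 = y₀) ∧ p.1 + p.2 = u
  card_union : (diagEnds P D x₀ y₀ ∪ antidiagEnds P A x₀ y₁).card = D.card + A.card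
  not_both : ∀ p ∈ P, p.1 - p.2 ∈ D → p.1 + p.2 ∉ A
  not_low_high : ∀ p ∈ P, (p.1 = x₀ ∨ p.2 = y₀) → (p.1 = x₁ ∨ p.2 = y₁) → p.1 - p.2 ∉ D
  not_left_right : ∀ p ∈ P, (p.1 = x₀ ∨ p.2 = y₁) → (p.1 = x₁ ∨ p.2 = y₀) → p.1 + p.2 ∉ A

/-- Equality in `CoveredRing.card_le` forces each of the four families of ends to be as large as
possible and all of them to be disjoint. -/
theorem CoveredRing.tight {P : Finset (ℤ × ℤ)} {D A : Finset ℤ} {x₀ x₁ y₀ y₁ : ℤ}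
    (h : CoveredRing P D A x₀ x₁ y₀ y₁) (hP : 2 * (D.card + A.card) ≤ P.card) :
    TightRing P D A x₀ x₁ y₀ y₁ := by
  have h1 := Finset.card_le_card h.subset_union
  have h2 := Finset.card_union_add_card_inter (diagEnds P D x₀ y₀ ∪ diagEnds P D x₁ y₁)
    (antidiagEnds P A x₀ y₁ ∪ antidiagEnds P A x₁ y₀)
  have h3 := Finset.card_union_add_card_inter (diagEnds P D x₀ y₀) (diagEnds P D x₁ y₁)
  have h4 := Finset.card_union_add_card_inter (antidiagEnds P A x₀ y₁) (antidiagEnds P A x₁ y₀)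
  have c1 := h.card_low
  have c2 := h.card_high
  have c3 := h.card_left
  have c4 := h.card_right
  have d1 : Disjoint (diagEnds P D x₀ y₀) (diagEnds P D x₁ y₁) :=
    Finset.disjoint_iff_inter_eq_empty.2 (Finset.card_eq_zero.1 (by omega))
  have d2 : Disjoint (antidiagEnds P A x₀ y₁) (antidiagEnds P A x₁ y₀) :=
    Finset.disjoint_iff_inter_eq_empty.2 (Finset.card_eq_zero.1 (by omega))
  have d3 : Disjoint (diagEnds P D x₀ y₀ ∪ diagEnds P D x₁ y₁)
      (antidiagEnds P A x₀ y₁ ∪ antidiagEnds P A x₁ y₀) :=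
    Finset.disjoint_iff_inter_eq_empty.2 (Finset.card_eq_zero.1 (by omega))
  have sd : ∀ x y, Set.InjOn (fun p : ℤ × ℤ => p.1 - p.2) (diagEnds P D x y) →
      D.card ≤ (diagEnds P D x y).card →
      ∀ v ∈ D, ∃ p ∈ P, (p.1 = x ∨ p.2 = y) ∧ p.1 - p.2 = v := by
    intro x y hi hc v hv
    have := Finset.surjOn_of_injOn_of_card_le _ (CoveredRing.mapsTo_diag x y) hi hc hv
    obtain ⟨p, hp, rfl⟩ := this
    rw [Finset.mem_coe, mem_diagEnds] at hp
    exact ⟨p, hp.1, hp.2.1, rfl⟩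
  have sa : ∀ x y, Set.InjOn (fun p : ℤ × ℤ => p.1 + p.2) (antidiagEnds P A x y) →
      A.card ≤ (antidiagEnds P A x y).card →
      ∀ v ∈ A, ∃ p ∈ P, (p.1 = x ∨ p.2 = y) ∧ p.1 + p.2 = v := by
    intro x y hi hc v hv
    have := Finset.surjOn_of_injOn_of_card_le _ (CoveredRing.mapsTo_antidiag x y) hi hc hv
    obtain ⟨p, hp, rfl⟩ := this
    rw [Finset.mem_coe, mem_antidiagEnds] at hp
    exact ⟨p, hp.1, hp.2.1, rfl⟩
  refine ⟨sd _ _ h.injOn_low (by omega), sd _ _ h.injOn_high (by omega),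
    sa _ _ h.injOn_left (by omega), sa _ _ h.injOn_right (by omega), ?_, ?_, ?_, ?_⟩
  · rw [Finset.card_union_of_disjoint]
    · omega
    · exact d3.mono Finset.subset_union_left Finset.subset_union_left
  · intro p hp hD hA
    have d := Finset.disjoint_left.1 d3
    refine d (a := p) ?_ ?_ <;>
      simp only [Finset.mem_union, mem_diagEnds, mem_antidiagEnds] <;>
      have := h.boundary p hp <;> tauto
  · intro p hp h1 h2 hD
    exact Finset.disjoint_left.1 d1 (mem_diagEnds.2 ⟨hp, h1, hD⟩) (mem_diagEnds.2 ⟨hp, h2, hD⟩)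
  · intro p hp h1 h2 hA
    exact Finset.disjoint_left.1 d2 (mem_antidiagEnds.2 ⟨hp, h1, hA⟩)
      (mem_antidiagEnds.2 ⟨hp, h2, hA⟩)

/-! ### Parity from two nested tight rings -/

/-- The points of the grid `X × Y` on the boundary of a rectangle. -/
def gridRing (X Y : Finset ℤ) (x₀ x₁ y₀ y₁ : ℤ) : Finset (ℤ × ℤ) :=
  (X ×ˢ Y).filter fun p => p.1 = x₀ ∨ p.1 = x₁ ∨ p.2 = y₀ ∨ p.2 = y₁

theorem mem_gridRing {X Y : Finset ℤ} {x₀ x₁ y₀ y₁ : ℤ} {p : ℤ × ℤ} :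
    p ∈ gridRing X Y x₀ x₁ y₀ y₁ ↔
      (p.1 ∈ X ∧ p.2 ∈ Y) ∧ (p.1 = x₀ ∨ p.1 = x₁ ∨ p.2 = y₀ ∨ p.2 = y₁) := by
  simp [gridRing]

/-- `x₀ < x₁` are the least and the greatest element of `X`. -/
structure Extremes (X : Finset ℤ) (x₀ x₁ : ℤ) : Prop where
  left_mem : x₀ ∈ X
  right_mem : x₁ ∈ X
  bounds : ∀ x ∈ X, x₀ ≤ x ∧ x ≤ x₁
  lt : x₀ < x₁

theorem exists_extremes {X : Finset ℤ} (h : 2 ≤ X.card) : ∃ x₀ x₁, Extremes X x₀ x₁ := by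
  have hX : X.Nonempty := Finset.card_pos.1 (by omega)
  refine ⟨X.min' hX, X.max' hX, X.min'_mem hX, X.max'_mem hX,
    fun x hx => ⟨X.min'_le x hx, X.le_max' x hx⟩, X.min'_lt_max'_of_card (by omega)⟩

/-- Two nested rings, both tight for the strips `|x - y| ≤ 2a` and `|x + y| ≤ 2b` of a board of
half-width `a + b`, the inner one completely filled: then the number of columns is even. -/
theorem even_card_of_tight_rings {X Y D A : Finset ℤ} {P : Finset (ℤ × ℤ)}
    {N a b x₀ x₁ y₀ y₁ z₀ z₁ w₀ w₁ : ℤ} (hab : a + b = N)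
    (hD : ∀ v ∈ D, |v| ≤ 2 * a) (hA : ∀ u ∈ A, |u| ≤ 2 * b)
    (hDmem : ∀ x ∈ X, ∀ y ∈ Y, |x - y| ≤ 2 * a → x - y ∈ D)
    (hAmem : ∀ x ∈ X, ∀ y ∈ Y, |x + y| ≤ 2 * b → x + y ∈ A)
    (hcov : ∀ x ∈ X, ∀ y ∈ Y, x - y ∈ D ∨ x + y ∈ A)
    (hX : Extremes X x₀ x₁) (hY : Extremes Y y₀ y₁)
    (hin : TightRing (gridRing X Y x₀ x₁ y₀ y₁) D A x₀ x₁ y₀ y₁)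
    (hz : z₀ < x₀ ∧ x₁ < z₁) (hw : w₀ < y₀ ∧ y₁ < w₁)
    (hN : -N ≤ w₀ ∧ w₁ ≤ N)
    (hP : ∀ p ∈ P, (p.1 = z₀ ∨ p.1 = z₁ ∨ p.1 ∈ X) ∧ (p.2 = w₀ ∨ p.2 = w₁ ∨ p.2 ∈ Y))
    (hout : TightRing P D A z₀ z₁ w₀ w₁) (hcard : D.card + A.card + 2 = X.card + Y.card) :
    Even X.card := by
  have ring : ∀ x ∈ X, ∀ y ∈ Y, (x = x₀ ∨ x = x₁ ∨ y = y₀ ∨ y = y₁) →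
      (x, y) ∈ gridRing X Y x₀ x₁ y₀ y₁ := fun x hx y hy h => mem_gridRing.2 ⟨⟨hx, hy⟩, h⟩
  have hx₀ := hX.left_mem
  have hx₁ := hX.right_mem
  have hy₀ := hY.left_mem
  have hy₁ := hY.right_mem
  have hXl := hX.lt
  have hYl := hY.lt
  have not_both : ∀ x ∈ X, ∀ y ∈ Y, (x = x₀ ∨ x = x₁ ∨ y = y₀ ∨ y = y₁) →
      x - y ∈ D → x + y ∉ A := fun x hx y hy h => hin.not_both _ (ring x hx y hy h)
  -- An antidiagonal through the lower left corner would have both its ends there, against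
  -- tightness, so a diagonal covers this corner. The other corners are treated in the same way.
  have bl : x₀ - y₀ ∈ D := (hcov _ hx₀ _ hy₀).resolve_right
    (hin.not_left_right _ (ring _ hx₀ _ hy₀ (.inl rfl)) (.inl rfl) (.inr rfl))
  have tr : x₁ - y₁ ∈ D := (hcov _ hx₁ _ hy₁).resolve_right
    (hin.not_left_right _ (ring _ hx₁ _ hy₁ (by simp)) (.inr rfl) (.inl rfl))
  have tl : x₀ + y₁ ∈ A := (hcov _ hx₀ _ hy₁).resolve_left
    (hin.not_low_high _ (ring _ hx₀ _ hy₁ (.inl rfl)) (.inl rfl) (.inr rfl))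
  have br : x₁ + y₀ ∈ A := (hcov _ hx₁ _ hy₀).resolve_left
    (hin.not_low_high _ (ring _ hx₁ _ hy₀ (by simp)) (.inr rfl) (.inl rfl))
  -- continuing a line of the cover to the outer ring
  have out_low : ∀ x ∈ X, ∀ y ∈ Y, x - y ∈ D → ∃ t, 0 < t ∧ (x - t = z₀ ∨ x - t ∈ X) ∧
      (y - t = w₀ ∨ y - t ∈ Y) := by
    intro x hx y hy h
    obtain ⟨p, hp, hp1, hp2⟩ := hout.low _ h
    have h1 := hX.bounds x hx
    have h2 := hY.bounds y hy
    have ht : 0 < x - p.1 := by omega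
    obtain ⟨h3, h4⟩ := hP p hp
    refine ⟨x - p.1, ht, ?_, ?_⟩
    · rw [sub_sub_cancel]
      rcases h3 with h3 | h3 | h3
      · exact .inl h3
      · omega
      · exact .inr h3
    · rw [show y - (x - p.1) = p.2 by omega]
      rcases h4 with h4 | h4 | h4
      · exact .inl h4
      · omega
      · exact .inr h4
  have out_high : ∀ x ∈ X, ∀ y ∈ Y, x - y ∈ D → ∃ t, 0 < t ∧ (x + t = z₁ ∨ x + t ∈ X) ∧
      (y + t = w₁ ∨ y + t ∈ Y) := by
    intro x hx y hy h
    obtain ⟨p, hp, hp1, hp2⟩ := hout.high _ h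
    have h1 := hX.bounds x hx
    have h2 := hY.bounds y hy
    have ht : 0 < p.1 - x := by omega
    obtain ⟨h3, h4⟩ := hP p hp
    refine ⟨p.1 - x, ht, ?_, ?_⟩
    · rw [add_sub_cancel]
      rcases h3 with h3 | h3 | h3
      · omega
      · exact .inl h3
      · exact .inr h3
    · rw [show y + (p.1 - x) = p.2 by omega]
      rcases h4 with h4 | h4 | h4
      · omega
      · exact .inl h4
      · exact .inr h4
  have out_left : ∀ x ∈ X, ∀ y ∈ Y, x + y ∈ A → ∃ t, 0 < t ∧ (x - t = z₀ ∨ x - t ∈ X) ∧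
      (y + t = w₁ ∨ y + t ∈ Y) := by
    intro x hx y hy h
    obtain ⟨p, hp, hp1, hp2⟩ := hout.left _ h
    have h1 := hX.bounds x hx
    have h2 := hY.bounds y hy
    have ht : 0 < x - p.1 := by omega
    obtain ⟨h3, h4⟩ := hP p hp
    refine ⟨x - p.1, ht, ?_, ?_⟩
    · rw [sub_sub_cancel]
      rcases h3 with h3 | h3 | h3
      · exact .inl h3
      · omega
      · exact .inr h3
    · rw [show y + (x - p.1) = p.2 by omega]
      rcases h4 with h4 | h4 | h4
      · omega
      · exact .inl h4
      · exact .inr h4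
  have out_right : ∀ x ∈ X, ∀ y ∈ Y, x + y ∈ A → ∃ t, 0 < t ∧ (x + t = z₁ ∨ x + t ∈ X) ∧
      (y - t = w₀ ∨ y - t ∈ Y) := by
    intro x hx y hy h
    obtain ⟨p, hp, hp1, hp2⟩ := hout.right _ h
    have h1 := hX.bounds x hx
    have h2 := hY.bounds y hy
    have ht : 0 < p.1 - x := by omega
    obtain ⟨h3, h4⟩ := hP p hp
    refine ⟨p.1 - x, ht, ?_, ?_⟩
    · rw [add_sub_cancel]
      rcases h3 with h3 | h3 | h3
      · omega
      · exact .inl h3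
      · exact .inr h3
    · rw [show y - (p.1 - x) = p.2 by omega]
      rcases h4 with h4 | h4 | h4
      · exact .inl h4
      · omega
      · exact .inr h4
  have below : ∀ y, y < y₀ → y ∉ Y := fun y h hy => by have := (hY.bounds y hy).1; omega
  have above : ∀ y, y₁ < y → y ∉ Y := fun y h hy => by have := (hY.bounds y hy).2; omega
  have lefts : ∀ x, x < x₀ → x ∉ X := fun y h hy => by have := (hX.bounds y hy).1; omega
  have rights : ∀ x, x₁ < x → x ∉ X := fun y h hy => by have := (hX.bounds y hy).2; omega
  -- The lines through the corners continue to the outer ring with equal horizontal and vertical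
  -- steps, so the outer ring has the same margin g on all four sides.
  obtain ⟨g, hg⟩ : ∃ g, g = y₀ - w₀ := ⟨_, rfl⟩
  have g1 : x₀ - z₀ = g := by
    obtain ⟨t, ht, h1, h2⟩ := out_low _ hx₀ _ hy₀ bl
    have := h1.resolve_right (lefts _ (by omega))
    have := h2.resolve_right (below _ (by omega))
    omega
  have g2 : z₁ - x₁ = g := by
    obtain ⟨t, ht, h1, h2⟩ := out_right _ hx₁ _ hy₀ br
    have := h1.resolve_right (rights _ (by omega))
    have := h2.resolve_right (below _ (by omega))
    omega
  have g3 : w₁ - y₁ = g := by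
    obtain ⟨t, ht, h1, h2⟩ := out_left _ hx₀ _ hy₁ tl
    have := h1.resolve_right (lefts _ (by omega))
    have := h2.resolve_right (above _ (by omega))
    omega
  -- Below the bottom row only the outer bottom row is available, so the diagonal steps by exactly
  -- g. A point on a diagonal of D is on no antidiagonal of A, so it is outside the antidiagonal
  -- strip; the lower right corner rules out the upper side.
  have bottomD : ∀ x ∈ X, x - y₀ ∈ D → (x ≠ x₀ → x - g ∈ X) ∧ x + y₀ < -(2 * b) := by
    intro x hx h
    constructor
    · intro hne
      obtain ⟨t, ht, h1, h2⟩ := out_low _ hx _ hy₀ h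
      have := h2.resolve_right (below _ (by omega))
      have h3 : t = g := by omega
      subst h3
      exact h1.resolve_left (by have := hX.bounds x hx; omega)
    · have h1 : ¬ |x + y₀| ≤ 2 * b := fun h' =>
        not_both _ hx _ hy₀ (by simp) h (hAmem _ hx _ hy₀ h')
      have h2 := abs_le.1 (hA _ br)
      have h3 := hX.bounds x hx
      rw [abs_le] at h1
      omega
  have bottomA : ∀ x ∈ X, x + y₀ ∈ A → (x ≠ x₁ → x + g ∈ X) ∧ 2 * a < x - y₀ := by
    intro x hx h
    constructor
    · intro hne
      obtain ⟨t, ht, h1, h2⟩ := out_right _ hx _ hy₀ h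
      have := h2.resolve_right (below _ (by omega))
      have h3 : t = g := by omega
      subst h3
      exact h1.resolve_left (by have := hX.bounds x hx; omega)
    · have h1 : ¬ |x - y₀| ≤ 2 * a := fun h' =>
        not_both _ hx _ hy₀ (by simp) (hDmem _ hx _ hy₀ h') h
      have h2 := abs_le.1 (hD _ bl)
      have h3 := hX.bounds x hx
      rw [abs_le] at h1
      omega
  have topA : ∀ x ∈ X, x + y₁ ∈ A → (x ≠ x₀ → x - g ∈ X) ∧ x - y₁ < -(2 * a) := by
    intro x hx h
    constructor
    · intro hne
      obtain ⟨t, ht, h1, h2⟩ := out_left _ hx _ hy₁ h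
      have := h2.resolve_right (above _ (by omega))
      have h3 : t = g := by omega
      subst h3
      exact h1.resolve_left (by have := hX.bounds x hx; omega)
    · have h1 : ¬ |x - y₁| ≤ 2 * a := fun h' =>
        not_both _ hx _ hy₁ (by simp) (hDmem _ hx _ hy₁ h') h
      have h2 := abs_le.1 (hD _ tr)
      have h3 := hX.bounds x hx
      rw [abs_le] at h1
      omega
  have topD : ∀ x ∈ X, x - y₁ ∈ D → (x ≠ x₁ → x + g ∈ X) ∧ 2 * b < x + y₁ := by
    intro x hx h
    constructor
    · intro hne
      obtain ⟨t, ht, h1, h2⟩ := out_high _ hx _ hy₁ h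
      have := h2.resolve_right (above _ (by omega))
      have h3 : t = g := by omega
      subst h3
      exact h1.resolve_left (by have := hX.bounds x hx; omega)
    · have h1 : ¬ |x + y₁| ≤ 2 * b := fun h' =>
        not_both _ hx _ hy₁ (by simp) h (hAmem _ hx _ hy₁ h')
      have h2 := abs_le.1 (hA _ tl)
      have h3 := hX.bounds x hx
      rw [abs_le] at h1
      omega
  have gpos : 0 < g := by omega
  -- the last column with a diagonal at the bottom, and the next column
  have hE : (X.filter fun x => x - y₀ ∈ D).Nonempty := ⟨x₀, by simp [hx₀, bl]⟩
  have hF : (X.filter fun x => x + y₀ ∈ A).Nonempty := ⟨x₁, by simp [hx₁, br]⟩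
  obtain ⟨e, he⟩ : ∃ e, e = (X.filter fun x => x - y₀ ∈ D).max' hE := ⟨_, rfl⟩
  obtain ⟨f, hf⟩ : ∃ f, f = (X.filter fun x => x + y₀ ∈ A).min' hF := ⟨_, rfl⟩
  have heX : e ∈ X ∧ e - y₀ ∈ D := by
    rw [he, ← Finset.mem_filter (p := fun x => x - y₀ ∈ D)]; exact Finset.max'_mem _ hE
  have hfX : f ∈ X ∧ f + y₀ ∈ A := by
    rw [hf, ← Finset.mem_filter (p := fun x => x + y₀ ∈ A)]; exact Finset.min'_mem _ hF
  have le_e : ∀ x ∈ X, x - y₀ ∈ D → x ≤ e := fun x hx h => by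
    rw [he]; exact Finset.le_max' _ _ (by simp [hx, h])
  have f_le : ∀ x ∈ X, x + y₀ ∈ A → f ≤ x := fun x hx h => by
    rw [hf]; exact Finset.min'_le _ _ (by simp [hx, h])
  -- The two strip inequalities give f - e > 2(a + b) + 2y₀ = 2(N + y₀), which is at least 2g
  -- because the outer row w₀ is at least -N.
  have hef : e + 2 * g < f := by
    have h1 := (bottomD e heX.1 heX.2).2
    have h2 := (bottomA f hfX.1 hfX.2).2
    omega
  have between : ∀ x, e < x → x < f → x ∉ X := by
    intro x h1 h2 hx
    rcases hcov x hx _ hy₀ with h | h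
    · have := le_e x hx h; omega
    · have := f_le x hx h; omega
  -- A diagonal at the top of column e would continue to a column e + g, inside the gap between e
  -- and f.
  have hetop : e + y₁ ∈ A := by
    refine (hcov e heX.1 _ hy₁).resolve_left fun h => ?_
    refine between (e + g) (by omega) (by omega) ((topD e heX.1 h).1 ?_)
    have := (hX.bounds f hfX.1).2
    omega
  have hftop : f - y₁ ∈ D := by
    refine (hcov f hfX.1 _ hy₁).resolve_right fun h => ?_
    refine between (f - g) (by omega) (by omega) ((topA f hfX.1 h).1 ?_)
    have := (hX.bounds e heX.1).1
    omega
  -- The columns split into left ones, on diagonals at the bottom and antidiagonals at the top, and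
  -- right ones with the roles exchanged.
  have key : ∀ x ∈ X, x - y₀ ∈ D ↔ x + y₁ ∈ A := by
    intro x hx
    constructor
    · intro h
      refine (hcov x hx _ hy₁).resolve_left fun h' => ?_
      have h1 := (topD x hx h').2
      have h2 := (topA e heX.1 hetop).2
      have h3 := le_e x hx h
      omega
    · intro h
      refine (hcov x hx _ hy₀).resolve_right fun h' => ?_
      have h1 := (topA x hx h).2
      have h2 := (topD f hfX.1 hftop).2
      have h3 := f_le x hx h'
      omega
  -- The left halves of all lines end in the first column and at both ends of the remaining left
  -- columns. By tightness their number is |D| + |A| = |X| + |Y| - 2, so |X| - 2 is twice the number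
  -- of those columns.
  have hunion : diagEnds (gridRing X Y x₀ x₁ y₀ y₁) D x₀ y₀ ∪
      antidiagEnds (gridRing X Y x₀ x₁ y₀ y₁) A x₀ y₁ =
      ({x₀} ×ˢ Y) ∪ ((X.filter fun x => x ≠ x₀ ∧ x - y₀ ∈ D) ×ˢ {y₀, y₁}) := by
    ext ⟨x, y⟩
    simp only [Finset.mem_union, mem_diagEnds, mem_antidiagEnds, mem_gridRing, Finset.mem_product,
      Finset.mem_singleton, Finset.mem_filter, Finset.mem_insert]
    constructor
    · rintro (⟨⟨⟨hx, hy⟩, -⟩, h1, h2⟩ | ⟨⟨⟨hx, hy⟩, -⟩, h1, h2⟩)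
      · by_cases h : x = x₀
        · exact .inl ⟨h, hy⟩
        · have h3 := h1.resolve_left h
          subst h3
          exact .inr ⟨⟨hx, h, h2⟩, .inl rfl⟩
      · by_cases h : x = x₀
        · exact .inl ⟨h, hy⟩
        · have h3 := h1.resolve_left h
          subst h3
          exact .inr ⟨⟨hx, h, (key x hx).2 h2⟩, .inr rfl⟩
    · rintro (⟨rfl, hy⟩ | ⟨⟨hx, h, h2⟩, rfl | rfl⟩)
      · rcases hcov x hx₀ y hy with h | h
        · exact .inl ⟨⟨⟨hx₀, hy⟩, .inl rfl⟩, .inl rfl, h⟩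
        · exact .inr ⟨⟨⟨hx₀, hy⟩, .inl rfl⟩, .inl rfl, h⟩
      · exact .inl ⟨⟨⟨hx, hy₀⟩, by simp⟩, .inr rfl, h2⟩
      · exact .inr ⟨⟨⟨hx, hy₁⟩, by simp⟩, .inr rfl, (key x hx).1 h2⟩
  have hc := hin.card_union
  rw [hunion, Finset.card_union_of_disjoint, Finset.card_product, Finset.card_product,
    Finset.card_singleton, Finset.card_pair hYl.ne] at hc
  · rw [Nat.even_iff]
    omega
  · rw [Finset.disjoint_left]
    rintro ⟨x, y⟩ h1 h2
    simp only [Finset.mem_product, Finset.mem_singleton, Finset.mem_filter] at h1 h2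
    exact h2.1.2.1 h1.1

/-! ### Peeling rings off a covered set -/

/-- The points of `S` lie in the grid `X × Y`, each on one of the diagonals in `D` or antidiagonals
in `A`. -/
structure Covered (S : Finset (ℤ × ℤ)) (X Y D A : Finset ℤ) : Prop where
  mem : ∀ p ∈ S, p.1 ∈ X ∧ p.2 ∈ Y
  covered : ∀ p ∈ S, p.1 - p.2 ∈ D ∨ p.1 + p.2 ∈ A

/-- `X` without its two extremes. -/
def trim (X : Finset ℤ) (x₀ x₁ : ℤ) : Finset ℤ := (X.erase x₀).erase x₁

theorem mem_trim {X : Finset ℤ} {x₀ x₁ x : ℤ} : x ∈ trim X x₀ x₁ ↔ x ≠ x₁ ∧ x ≠ x₀ ∧ x ∈ X := by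
  simp [trim]

theorem Extremes.card_trim {X : Finset ℤ} {x₀ x₁ : ℤ} (h : Extremes X x₀ x₁) :
    (trim X x₀ x₁).card + 2 = X.card := by
  have h1 := Finset.card_erase_add_one h.left_mem
  have h2 := Finset.card_erase_add_one (Finset.mem_erase.2 ⟨h.lt.ne', h.right_mem⟩)
  unfold trim
  omega

/-- The points of `S` on the boundary of the rectangle with corners `(x₀, y₀)`, `(x₁, y₁)`. -/
def outerPart (S : Finset (ℤ × ℤ)) (x₀ x₁ y₀ y₁ : ℤ) : Finset (ℤ × ℤ) :=
  S.filter fun p => p.1 = x₀ ∨ p.1 = x₁ ∨ p.2 = y₀ ∨ p.2 = y₁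

/-- The points of `S` off the boundary of the rectangle with corners `(x₀, y₀)`, `(x₁, y₁)`. -/
def innerPart (S : Finset (ℤ × ℤ)) (x₀ x₁ y₀ y₁ : ℤ) : Finset (ℤ × ℤ) :=
  S.filter fun p => ¬ (p.1 = x₀ ∨ p.1 = x₁ ∨ p.2 = y₀ ∨ p.2 = y₁)

theorem card_outerPart_add_card_innerPart (S : Finset (ℤ × ℤ)) (x₀ x₁ y₀ y₁ : ℤ) :
    (outerPart S x₀ x₁ y₀ y₁).card + (innerPart S x₀ x₁ y₀ y₁).card = S.card :=
  Finset.card_filter_add_card_filter_not _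

namespace Covered

variable {S : Finset (ℤ × ℤ)} {X Y D A : Finset ℤ} {x₀ x₁ y₀ y₁ : ℤ}

theorem card_le (h : Covered S X Y D A) : S.card ≤ X.card * Y.card := by
  rw [← Finset.card_product]
  exact Finset.card_le_card fun p hp => Finset.mem_product.2 (h.mem p hp)

theorem outerPart (h : Covered S X Y D A) (hX : Extremes X x₀ x₁) (hY : Extremes Y y₀ y₁) :
    CoveredRing (outerPart S x₀ x₁ y₀ y₁) D A x₀ x₁ y₀ y₁ := by
  refine ⟨fun p hp => ?_, fun p hp => ?_, fun p hp => ?_⟩ <;> obtain ⟨h1, h2⟩ := Finset.mem_filter.1 hp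
  · have h3 := h.mem p h1
    have h4 := hX.bounds _ h3.1
    have h5 := hY.bounds _ h3.2
    exact ⟨h4.1, h4.2, h5.1, h5.2⟩
  · exact h2
  · exact h.covered p h1

theorem innerPart (h : Covered S X Y D A) :
    Covered (innerPart S x₀ x₁ y₀ y₁) (trim X x₀ x₁) (trim Y y₀ y₁) D A := by
  refine ⟨fun p hp => ?_, fun p hp => ?_⟩ <;> obtain ⟨h1, h2⟩ := Finset.mem_filter.1 hp
  · have h3 := h.mem p h1
    push Not at h2
    exact ⟨mem_trim.2 ⟨h2.2.1, h2.1, h3.1⟩, mem_trim.2 ⟨h2.2.2.2, h2.2.2.1, h3.2⟩⟩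
  · exact h.covered p h1

theorem card_le_add (h : Covered S X Y D A) (hX : Extremes X x₀ x₁) (hY : Extremes Y y₀ y₁) :
    S.card ≤ 2 * (D.card + A.card) + (_root_.innerPart S x₀ x₁ y₀ y₁).card := by
  have h1 := card_outerPart_add_card_innerPart S x₀ x₁ y₀ y₁
  have h2 := (h.outerPart hX hY).card_le
  omega

/-- Each row contains at most one point of each line of the cover. -/
theorem card_le_row_mul (h : Covered S X Y D A) : S.card ≤ Y.card * (D.card + A.card) := by
  have : S ⊆ (Y ×ˢ D).image (fun q => (q.1 + q.2, q.1)) ∪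
      (Y ×ˢ A).image (fun q => (q.2 - q.1, q.1)) := by
    intro p hp
    have h1 := h.mem p hp
    rw [Finset.mem_union, Finset.mem_image, Finset.mem_image]
    rcases h.covered p hp with h2 | h2
    · exact .inl ⟨(p.2, p.1 - p.2), Finset.mem_product.2 ⟨h1.2, h2⟩, Prod.ext (by simp) rfl⟩
    · exact .inr ⟨(p.2, p.1 + p.2), Finset.mem_product.2 ⟨h1.2, h2⟩, Prod.ext (by simp) rfl⟩
  have h2 := Finset.card_le_card this
  have h3 := Finset.card_union_le ((Y ×ˢ D).image (fun q => (q.1 + q.2, q.1)))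
      ((Y ×ˢ A).image (fun q => (q.2 - q.1, q.1)))
  have h4 := Finset.card_image_le (s := Y ×ˢ D) (f := fun q => (q.1 + q.2, q.1))
  have h5 := Finset.card_image_le (s := Y ×ˢ A) (f := fun q => (q.2 - q.1, q.1))
  rw [Finset.card_product] at h4 h5
  rw [mul_add]
  omega

theorem swap (h : Covered S X Y D A) :
    Covered (S.image Prod.swap) Y X (D.image fun v => -v) A := by
  refine ⟨fun p hp => ?_, fun p hp => ?_⟩ <;> obtain ⟨q, hq, rfl⟩ := Finset.mem_image.1 hp
  · exact (h.mem q hq).symm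
  · rcases h.covered q hq with h1 | h1
    · exact .inl (Finset.mem_image.2 ⟨_, h1, by simp⟩)
    · exact .inr (by simpa [add_comm] using h1)

theorem card_image_swap : (S.image Prod.swap).card = S.card :=
  Finset.card_image_of_injective _ Prod.swap_injective

theorem card_image_neg : (D.image fun v => -v).card = D.card :=
  Finset.card_image_of_injective _ neg_injective

theorem card_le_column_mul (h : Covered S X Y D A) : S.card ≤ X.card * (D.card + A.card) := by
  have := h.swap.card_le_row_mul
  rwa [card_image_swap, card_image_neg] at this

/-- The bound obtained by peeling off one ring after the other. -/
theorem four_mul_card_le (k : ℕ) : ∀ (S : Finset (ℤ × ℤ)) (X Y : Finset ℤ) (d : ℤ),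
    Covered S X Y D A → (X.card : ℤ) + Y.card = D.card + A.card + d →
    (X.card : ℤ) ≤ Y.card + (D.card + A.card) → (Y.card : ℤ) ≤ X.card + (D.card + A.card) →
    -2 ≤ d → d ≤ 4 * k + 2 →
    4 * (S.card : ℤ) ≤ 4 * (X.card * Y.card) - d ^ 2 + 4 ∧
      (4 ∣ d → 4 * (S.card : ℤ) ≤ 4 * (X.card * Y.card) - d ^ 2) := by
  induction k with
  -- For |d| ≤ 2 the term 4 - d² is nonnegative and the trivial bound suffices; 4 ∣ d leaves only d
  -- = 0.
  | zero =>
    intro S X Y d h hd h1 h2 h3 h4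
    have h5 : (S.card : ℤ) ≤ X.card * Y.card := by exact_mod_cast h.card_le
    have h6 : d ≤ 2 := by simpa using h4
    interval_cases d <;> omega
  | succ k ih =>
    intro S X Y d h hd h1 h2 h3 h4
    by_cases h5 : d ≤ 4 * k + 2
    · exact ih S X Y d h hd h1 h2 h3 h5
    -- The two triangle inequalities give 2|X| ≥ d and 2|Y| ≥ d, and d ≥ 3 here.
    obtain ⟨x₀, x₁, hX⟩ := exists_extremes (X := X) (by omega)
    obtain ⟨y₀, y₁, hY⟩ := exists_extremes (X := Y) (by omega)
    have h6 := hX.card_trim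
    have h7 := hY.card_trim
    have h8 := h.card_le_add hX hY
    -- Both sides of the grid lose two while the cover is kept, so d drops by 4 and the triangle
    -- inequalities persist.
    have h9 := ih _ _ _ (d - 4) (h.innerPart (x₀ := x₀) (x₁ := x₁) (y₀ := y₀) (y₁ := y₁))
      (by omega) (by omega) (by omega) (by omega) (by push_cast at h4; omega)
    have e1 : ((trim X x₀ x₁).card : ℤ) = X.card - 2 := by omega
    have e2 : ((trim Y y₀ y₁).card : ℤ) = Y.card - 2 := by omega
    rw [e1, e2] at h9
    zify at h8
    constructor
    · nlinarith [h9.1]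
    · intro h10
      nlinarith [h9.2 (by omega)]

end Covered

/-- A covered set on a board of half-width `N = a + b`, the cover consisting of lines of the
diagonal strip of half-width `a` and of the antidiagonal strip of half-width `b` and containing all
lines of these strips through points of the set. -/
structure StripCovered (S : Finset (ℤ × ℤ)) (X Y D A : Finset ℤ) (N a b : ℤ) : Prop
    extends Covered S X Y D A where
  add_eq : a + b = N
  column_bound : ∀ x ∈ X, |x| ≤ N
  row_bound : ∀ y ∈ Y, |y| ≤ N
  diag_bound : ∀ v ∈ D, |v| ≤ 2 * a
  antidiag_bound : ∀ u ∈ A, |u| ≤ 2 * b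
  diag_mem : ∀ p ∈ S, |p.1 - p.2| ≤ 2 * a → p.1 - p.2 ∈ D
  antidiag_mem : ∀ p ∈ S, |p.1 + p.2| ≤ 2 * b → p.1 + p.2 ∈ A

namespace StripCovered

variable {S : Finset (ℤ × ℤ)} {X Y D A : Finset ℤ} {N a b : ℤ} {x₀ x₁ y₀ y₁ : ℤ}

theorem swap (h : StripCovered S X Y D A N a b) :
    StripCovered (S.image Prod.swap) Y X (D.image fun v => -v) A N a b := by
  refine ⟨h.toCovered.swap, h.add_eq, h.row_bound, h.column_bound, fun v hv => ?_,
    h.antidiag_bound, fun p hp h1 => ?_, fun p hp h1 => ?_⟩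
  · obtain ⟨w, hw, rfl⟩ := Finset.mem_image.1 hv
    rw [abs_neg]
    exact h.diag_bound w hw
  · obtain ⟨q, hq, rfl⟩ := Finset.mem_image.1 hp
    refine Finset.mem_image.2 ⟨q.1 - q.2, h.diag_mem q hq ?_, by simp⟩
    rw [abs_sub_comm]
    exact h1
  · obtain ⟨q, hq, rfl⟩ := Finset.mem_image.1 hp
    have := h.antidiag_mem q hq (by rw [add_comm]; exact h1)
    rw [add_comm] at this
    exact this

theorem innerPart (h : StripCovered S X Y D A N a b) :
    StripCovered (_root_.innerPart S x₀ x₁ y₀ y₁) (trim X x₀ x₁) (trim Y y₀ y₁) D A N a b :=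
  ⟨h.toCovered.innerPart, h.add_eq, fun x hx => h.column_bound x (mem_trim.1 hx).2.2,
    fun y hy => h.row_bound y (mem_trim.1 hy).2.2, h.diag_bound, h.antidiag_bound,
    fun p hp => h.diag_mem p (Finset.mem_filter.1 hp).1,
    fun p hp => h.antidiag_mem p (Finset.mem_filter.1 hp).1⟩

/-- A completely covered grid without uncovered points on its boundary has at least two rows and
two columns. -/
theorem two_le_of_full (h : Covered S X Y D A) (hS : S = X ×ˢ Y)
    (hd : X.card + Y.card = D.card + A.card + 2) (h1 : X.card ≤ Y.card + (D.card + A.card)) :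
    2 ≤ Y.card := by
  by_contra hlt
  have h2 := h.card_le_row_mul
  rw [hS, Finset.card_product] at h2
  have : Y.card = 0 ∨ Y.card = 1 := by omega
  rcases this with h3 | h3
  · omega
  · rw [h3] at h2
    omega

/-- For d = 6 the outer ring alone must miss eight grid points. If no others are missing, that ring
is tight and the inner grid is full; the inner grid has d = 2, so its own ring has exactly twice as
many points as there are lines and is tight too. -/
theorem even_of_two_rings (h : StripCovered S X Y D A N a b)
    (hd : X.card + Y.card = D.card + A.card + 6)
    (h1 : X.card ≤ Y.card + (D.card + A.card)) (h2 : Y.card ≤ X.card + (D.card + A.card))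
    (hS : X.card * Y.card ≤ S.card + 8) : Even X.card := by
  obtain ⟨x₀, x₁, hX⟩ := exists_extremes (X := X) (by omega)
  obtain ⟨y₀, y₁, hY⟩ := exists_extremes (X := Y) (by omega)
  have h6 := hX.card_trim
  have h7 := hY.card_trim
  have h' := h.innerPart (x₀ := x₀) (x₁ := x₁) (y₀ := y₀) (y₁ := y₁)
  have h8 := card_outerPart_add_card_innerPart S x₀ x₁ y₀ y₁
  have h9 := (h.toCovered.outerPart hX hY).card_le
  have h10 := h'.toCovered.card_le
  have h11 : (trim X x₀ x₁).card * (trim Y y₀ y₁).card + 2 * (X.card + Y.card) =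
      X.card * Y.card + 4 := by
    rw [← h6, ← h7]; ring
  have hfull : _root_.innerPart S x₀ x₁ y₀ y₁ = trim X x₀ x₁ ×ˢ trim Y y₀ y₁ := by
    refine Finset.eq_of_subset_of_card_le
      (fun p hp => Finset.mem_product.2 (h'.mem p hp)) ?_
    rw [Finset.card_product]
    omega
  have hout := (h.toCovered.outerPart hX hY).tight (by omega)
  have hYc := two_le_of_full h'.toCovered hfull (by omega) (by omega)
  have hXc : 2 ≤ (trim X x₀ x₁).card := by
    refine two_le_of_full h'.toCovered.swap ?_ ?_ ?_
    · rw [hfull]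
      ext ⟨x, y⟩
      simp [and_comm]
    · rw [Covered.card_image_neg]; omega
    · rw [Covered.card_image_neg]; omega
  obtain ⟨s₀, s₁, hX'⟩ := exists_extremes hXc
  obtain ⟨t₀, t₁, hY'⟩ := exists_extremes hYc
  have mem : ∀ x ∈ trim X x₀ x₁, ∀ y ∈ trim Y y₀ y₁, (x, y) ∈ _root_.innerPart S x₀ x₁ y₀ y₁ :=
    fun x hx y hy => by rw [hfull]; exact Finset.mem_product.2 ⟨hx, hy⟩
  have hring : CoveredRing (gridRing (trim X x₀ x₁) (trim Y y₀ y₁) s₀ s₁ t₀ t₁) D A s₀ s₁ t₀ t₁ := by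
    refine ⟨fun p hp => ?_, fun p hp => (mem_gridRing.1 hp).2, fun p hp => ?_⟩
    · have := mem_gridRing.1 hp
      have h3 := hX'.bounds _ this.1.1
      have h4 := hY'.bounds _ this.1.2
      exact ⟨h3.1, h3.2, h4.1, h4.2⟩
    · have := mem_gridRing.1 hp
      exact h'.covered p (mem _ this.1.1 _ this.1.2)
  have hcard : (gridRing (trim X x₀ x₁) (trim Y y₀ y₁) s₀ s₁ t₀ t₁).card + 4 =
      2 * ((trim X x₀ x₁).card + (trim Y y₀ y₁).card) := by
    have e1 := card_outerPart_add_card_innerPart (trim X x₀ x₁ ×ˢ trim Y y₀ y₁) s₀ s₁ t₀ t₁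
    have e2 : _root_.innerPart (trim X x₀ x₁ ×ˢ trim Y y₀ y₁) s₀ s₁ t₀ t₁ =
        trim (trim X x₀ x₁) s₀ s₁ ×ˢ trim (trim Y y₀ y₁) t₀ t₁ := by
      ext ⟨x, y⟩
      simp only [_root_.innerPart, Finset.mem_filter, Finset.mem_product, mem_trim]
      tauto
    rw [e2, Finset.card_product, Finset.card_product] at e1
    have e3 := hX'.card_trim
    have e4 := hY'.card_trim
    have e5 : (gridRing (trim X x₀ x₁) (trim Y y₀ y₁) s₀ s₁ t₀ t₁) =
        _root_.outerPart (trim X x₀ x₁ ×ˢ trim Y y₀ y₁) s₀ s₁ t₀ t₁ := rfl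
    rw [e5]
    rw [← e3, ← e4] at e1 ⊢
    nlinarith
  have hin := hring.tight (by omega)
  have hXb : ∀ x ∈ trim X x₀ x₁, x₀ < x ∧ x < x₁ := fun x hx => by
    have e1 := mem_trim.1 hx
    have e2 := hX.bounds x e1.2.2
    omega
  have hYb : ∀ y ∈ trim Y y₀ y₁, y₀ < y ∧ y < y₁ := fun y hy => by
    have e1 := mem_trim.1 hy
    have e2 := hY.bounds y e1.2.2
    omega
  have heven := even_card_of_tight_rings h.add_eq h.diag_bound h.antidiag_bound
    (fun x hx y hy => h'.diag_mem _ (mem x hx y hy))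
    (fun x hx y hy => h'.antidiag_mem _ (mem x hx y hy))
    (fun x hx y hy => h'.covered _ (mem x hx y hy)) hX' hY' hin
    (z₀ := x₀) (z₁ := x₁) (w₀ := y₀) (w₁ := y₁)
    ⟨(hXb _ hX'.left_mem).1, (hXb _ hX'.right_mem).2⟩
    ⟨(hYb _ hY'.left_mem).1, (hYb _ hY'.right_mem).2⟩
    ⟨(abs_le.1 (h.row_bound _ hY.left_mem)).1, (abs_le.1 (h.row_bound _ hY.right_mem)).2⟩
    (fun p hp => by
      have e1 := h.mem p (Finset.mem_filter.1 hp).1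
      rw [mem_trim, mem_trim]
      tauto) hout (by omega)
  rw [Nat.even_iff] at heven ⊢
  omega

/-- The improved bound for a grid with an odd number of columns or rows. -/
theorem four_mul_card_le (k : ℕ) : ∀ (S : Finset (ℤ × ℤ)) (X Y : Finset ℤ) (d : ℤ),
    StripCovered S X Y D A N a b → (X.card : ℤ) + Y.card = D.card + A.card + d →
    (X.card : ℤ) ≤ Y.card + (D.card + A.card) → (Y.card : ℤ) ≤ X.card + (D.card + A.card) →
    d = 4 * k + 6 → Odd X.card ∨ Odd Y.card →
    4 * (S.card : ℤ) ≤ 4 * (X.card * Y.card) - d ^ 2 := by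
  induction k with
  | zero =>
    intro S X Y d h hd h1 h2 h3 h4
    obtain ⟨h5, -⟩ := Covered.four_mul_card_le 1 S X Y d h.toCovered hd h1 h2 (by omega) (by omega)
    simp only [Nat.cast_zero, mul_zero, zero_add] at h3
    subst h3
    by_contra hlt
    -- For d = 6, failure of the bound means that at most eight grid points are missing.
    have h6 : X.card * Y.card ≤ S.card + 8 := by zify; linarith
    rcases h4 with h4 | h4
    · exact Nat.not_even_iff_odd.2 h4
        (h.even_of_two_rings (by omega) (by omega) (by omega) h6)
    · refine Nat.not_even_iff_odd.2 h4 (h.swap.even_of_two_rings ?_ ?_ ?_ ?_)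
      · rw [Covered.card_image_neg]; omega
      · rw [Covered.card_image_neg]; omega
      · rw [Covered.card_image_neg]; omega
      · rwa [Covered.card_image_swap, mul_comm]
  | succ k ih =>
    intro S X Y d h hd h1 h2 h3 h4
    obtain ⟨x₀, x₁, hX⟩ := exists_extremes (X := X) (by omega)
    obtain ⟨y₀, y₁, hY⟩ := exists_extremes (X := Y) (by omega)
    have h6 := hX.card_trim
    have h7 := hY.card_trim
    have h8 := h.toCovered.card_le_add hX hY
    -- Trimming removes two columns and two rows, so parities survive down to d = 6.
    have h9 := ih _ _ _ (d - 4) (h.innerPart (x₀ := x₀) (x₁ := x₁) (y₀ := y₀) (y₁ := y₁))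
      (by omega) (by omega) (by omega) (by push_cast at h3; omega)
      (by simp only [Nat.odd_iff] at h4 ⊢; omega)
    have e1 : ((trim X x₀ x₁).card : ℤ) = X.card - 2 := by omega
    have e2 : ((trim Y y₀ y₁).card : ℤ) = Y.card - 2 := by omega
    rw [e1, e2] at h9
    zify at h8
    nlinarith

end StripCovered

/-! ### Bounding the size of a covered set by `G` -/

/-- Three lines do not cover a grid of three columns and two rows. -/
theorem Covered.card_le_five {S : Finset (ℤ × ℤ)} {X Y D A : Finset ℤ} (h : Covered S X Y D A)
    (hX3 : X.card = 3) (hY2 : Y.card = 2) (hs : D.card + A.card = 3) : S.card ≤ 5 := by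
  by_contra hlt
  obtain ⟨x₀, x₁, hX⟩ := exists_extremes (X := X) (by omega)
  obtain ⟨y₀, y₁, hY⟩ := exists_extremes (X := Y) (by omega)
  have h6 := hX.card_trim
  have h7 := hY.card_trim
  obtain ⟨z, hz⟩ := Finset.card_eq_one.1 (show (trim X x₀ x₁).card = 1 by omega)
  have hY0 := Finset.card_eq_zero.1 (show (trim Y y₀ y₁).card = 0 by omega)
  have hXmem : ∀ x ∈ X, x = x₀ ∨ x = z ∨ x = x₁ := by
    intro x hx
    by_contra hne
    have : x ∈ trim X x₀ x₁ := mem_trim.2 (by tauto)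
    rw [hz, Finset.mem_singleton] at this
    tauto
  have hYmem : ∀ y ∈ Y, y = y₀ ∨ y = y₁ := by
    intro y hy
    by_contra hne
    have : y ∈ trim Y y₀ y₁ := mem_trim.2 (by tauto)
    rw [hY0] at this
    exact absurd this (Finset.notMem_empty y)
  have hzm := mem_trim.1 (show z ∈ trim X x₀ x₁ by rw [hz]; exact Finset.mem_singleton_self z)
  have hzb := hX.bounds z hzm.2.2
  have hfull : S = X ×ˢ Y := by
    refine Finset.eq_of_subset_of_card_le (fun p hp => Finset.mem_product.2 (h.mem p hp)) ?_
    rw [Finset.card_product, hX3, hY2]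
    omega
  have mem : ∀ x ∈ X, ∀ y ∈ Y, (x, y) ∈ S := fun x hx y hy => by
    rw [hfull]; exact Finset.mem_product.2 ⟨hx, hy⟩
  have hring : CoveredRing S D A x₀ x₁ y₀ y₁ := by
    refine ⟨fun p hp => ?_, fun p hp => ?_, h.covered⟩
    · have h1 := h.mem p hp
      have h2 := hX.bounds _ h1.1
      have h3 := hY.bounds _ h1.2
      omega
    · have h1 := hYmem _ (h.mem p hp).2
      tauto
  have ht := hring.tight (by omega)
  have hx₀ := hX.left_mem
  have hx₁ := hX.right_mem
  have hy₀ := hY.left_mem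
  have hy₁ := hY.right_mem
  have hyl := hY.lt
  have points : ∀ p ∈ S, (p.1 = x₀ ∨ p.1 = z ∨ p.1 = x₁) ∧ (p.2 = y₀ ∨ p.2 = y₁) := fun p hp =>
    ⟨hXmem _ (h.mem p hp).1, hYmem _ (h.mem p hp).2⟩
  -- Six points on three lines form a tight ring. Following the diagonals (or antidiagonals) through
  -- the bottom points shows that the columns have spacing y₁ - y₀, so the middle bottom point is on
  -- lines of both kinds.
  rcases h.covered _ (mem z hzm.2.2 y₀ hy₀) with h1 | h1
  · have bl : x₀ - y₀ ∈ D := (h.covered _ (mem _ hx₀ _ hy₀)).resolve_right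
      (ht.not_left_right _ (mem _ hx₀ _ hy₀) (.inl rfl) (.inr rfl))
    have tl : x₀ + y₁ ∈ A := (h.covered _ (mem _ hx₀ _ hy₁)).resolve_left
      (ht.not_low_high _ (mem _ hx₀ _ hy₁) (.inl rfl) (.inr rfl))
    obtain ⟨p, hp, hp1, hp2⟩ := ht.high _ h1
    obtain ⟨q, hq, hq1, hq2⟩ := ht.high _ bl
    have := points p hp
    have := points q hq
    dsimp only at hp2
    refine ht.not_both _ (mem z hzm.2.2 y₀ hy₀) h1 ?_
    rw [show (z, y₀).1 + (z, y₀).2 = x₀ + y₁ by dsimp only; omega]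
    exact tl
  · have br : x₁ + y₀ ∈ A := (h.covered _ (mem _ hx₁ _ hy₀)).resolve_left
      (ht.not_low_high _ (mem _ hx₁ _ hy₀) (.inr rfl) (.inl rfl))
    have tr : x₁ - y₁ ∈ D := (h.covered _ (mem _ hx₁ _ hy₁)).resolve_right
      (ht.not_left_right _ (mem _ hx₁ _ hy₁) (.inr rfl) (.inl rfl))
    obtain ⟨p, hp, hp1, hp2⟩ := ht.left _ h1
    obtain ⟨q, hq, hq1, hq2⟩ := ht.left _ br
    have := points p hp
    have := points q hq
    dsimp only at hp2
    refine ht.not_both _ (mem z hzm.2.2 y₀ hy₀) ?_ h1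
    rw [show (z, y₀).1 - (z, y₀).2 = x₁ - y₁ by dsimp only; omega]
    exact tr

theorem div_le_G (m : ℕ) : m ^ 2 / 12 ≤ G m := by
  unfold G
  split_ifs <;> omega

theorem le_G_of_le_sq {k m : ℕ} (h : 12 * k ≤ m ^ 2) : k ≤ G m :=
  le_trans ((Nat.le_div_iff_mul_le (by norm_num)).2 (by omega)) (div_le_G m)

theorem le_G_of_mul_le_sq {k m : ℕ} (h : 16 * k ≤ m ^ 2) : k ≤ G m :=
  le_G_of_le_sq (by omega)

theorem four_mul_mul_le_add_sq (x y : ℕ) : 4 * (x * y) ≤ (x + y) ^ 2 := by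
  zify
  nlinarith [sq_nonneg ((x : ℤ) - y)]

/-- For the cases where one of the counts of columns, rows and slanted lines exceeds the sum of the
other two: the product of those two is then at most m²/16. -/
theorem le_G_of_le_mul {k x y m : ℕ} (h : k ≤ x * y) (hm : 2 * (x + y) ≤ m) : k ≤ G m := by
  have h1 := four_mul_mul_le_add_sq x y
  have h2 : (2 * (x + y)) ^ 2 ≤ m ^ 2 := Nat.pow_le_pow_left hm 2
  have h3 : (2 * (x + y)) ^ 2 = 4 * (x + y) ^ 2 := by ring
  exact le_G_of_mul_le_sq (by omega)

theorem sq_mod_twelve (m : ℕ) : m ^ 2 % 12 = (m % 12) ^ 2 % 12 := Nat.pow_mod m 2 12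

/-- The number of queens in terms of the number of rows, columns and diagonals of the strips. -/
theorem StripCovered.card_le_G {S : Finset (ℤ × ℤ)} {X Y D A : Finset ℤ} {N a b : ℤ}
    (h : StripCovered S X Y D A N a b) :
    S.card ≤ G (X.card + Y.card + (D.card + A.card)) := by
  have b1 := h.toCovered.card_le
  have b2 := h.toCovered.card_le_row_mul
  have b3 := h.toCovered.card_le_column_mul
  have hm8 : X.card = 3 → Y.card = 2 → D.card + A.card = 3 → S.card ≤ 5 := h.toCovered.card_le_five
  have hm8' : X.card = 2 → Y.card = 3 → D.card + A.card = 3 → S.card ≤ 5 := by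
    intro h1 h2 h3
    have := h.toCovered.swap.card_le_five h2 h1 (by rwa [Covered.card_image_neg])
    rwa [Covered.card_image_swap] at this
  have main := fun d hd h1 h2 h3 => Covered.four_mul_card_le d.toNat S X Y d h.toCovered hd h1 h2 h3
  have main' := fun d hd h1 h2 h3 =>
    h.four_mul_card_le ((d - 6) / 4).toNat S X Y d hd h1 h2 h3
  generalize S.card = k at *
  generalize X.card = r at *
  generalize Y.card = c at *
  simp only [← Nat.cast_add] at main main'
  generalize D.card + A.card = s at *
  clear h
  obtain ⟨m, hm⟩ : ∃ m, m = r + c + s := ⟨_, rfl⟩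
  rw [← hm]
  by_cases t1 : r ≤ c + s
  swap
  · exact le_G_of_le_mul b2 (by omega)
  by_cases t2 : c ≤ r + s
  swap
  · exact le_G_of_le_mul b3 (by omega)
  by_cases t3 : s ≤ r + c
  swap
  · exact le_G_of_le_mul b1 (by omega)
  obtain ⟨d, hd⟩ : ∃ d : ℤ, d = r + c - s := ⟨_, rfl⟩
  obtain ⟨u, hu⟩ := main d (by omega) (by omega) (by omega) (by omega) (by omega)
  -- Completing squares: the maximum is at r = c = m/3, and e and f measure the deviation from it.
  have hid : 3 * (4 * ((r : ℤ) * c) - d ^ 2) =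
      m ^ 2 - (3 * (r + c) - 2 * m) ^ 2 - 3 * (r - c) ^ 2 := by
    rw [hd, hm]; push_cast; ring
  obtain ⟨e, he⟩ : ∃ e : ℤ, e = 3 * (r + c) - 2 * m := ⟨_, rfl⟩
  obtain ⟨f, hf⟩ : ∃ f : ℤ, f = r - c := ⟨_, rfl⟩
  rw [← he, ← hf] at hid
  have he0 := sq_nonneg e
  have hf0 := sq_nonneg f
  have big : ∀ (x z : ℤ), (z ≤ x ∨ x ≤ -z) → 0 ≤ z → z * z ≤ x ^ 2 := by
    intro x z hx hz
    rcases hx with hx | hx <;> nlinarith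
  have hk0 : 12 * (k : ℤ) ≤ m ^ 2 + 12 - e ^ 2 - 3 * f ^ 2 := by linarith
  have hmsq := sq_mod_twelve m
  by_cases hG : m % 12 = 3 ∨ m % 12 = 6 ∨ m % 12 = 9 ∨ m = 10
  · unfold G
    rw [if_pos hG]
    have : 12 * k ≤ m ^ 2 + 12 := by zify; linarith
    omega
  push Not at hG
  -- For odd d, d² ≡ 1 mod 4 reduces the loss of 4 to 1, and m² ≡ 1 mod 12 absorbs the rest.
  by_cases hodd : m % 2 = 1
  · have h1 : d % 2 = 1 := by omega
    have h2 : d ^ 2 % 4 = 1 := by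
      rw [pow_two, Int.mul_emod]
      have : d % 4 = 1 ∨ d % 4 = 3 := by omega
      rcases this with h | h <;> rw [h] <;> rfl
    have h3 : 12 * (k : ℤ) ≤ m ^ 2 + 3 := by omega
    have h4 : 12 * k ≤ m ^ 2 + 3 := by exact_mod_cast h3
    have h5 : m ^ 2 % 12 = 1 := by
      have : m % 12 = 1 ∨ m % 12 = 5 ∨ m % 12 = 7 ∨ m % 12 = 11 := by omega
      rcases this with h | h | h | h <;> (rw [hmsq, h]; norm_num)
    exact le_G_of_le_sq (by omega)
  by_cases hd4 : d % 4 = 0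
  · have h1 := hu (by omega)
    refine le_G_of_le_sq ?_
    zify
    linarith
  have hd2 : d % 4 = 2 := by omega
  have hm4 : m % 12 = 0 ∨ (m % 3 ≠ 0 ∧ m ^ 2 % 12 = 4) := by
    have : m % 12 = 0 ∨ m % 12 = 2 ∨ m % 12 = 4 ∨ m % 12 = 8 ∨ m % 12 = 10 := by omega
    rcases this with h | h | h | h | h
    · exact .inl h
    all_goals exact .inr ⟨by omega, by (rw [hmsq, h]; norm_num)⟩
  by_cases hd6 : 6 ≤ d
  · by_cases ho : Odd r ∨ Odd c
    · have h1 := main' d (by omega) (by omega) (by omega) (by omega) ho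
      refine le_G_of_le_sq ?_
      zify
      linarith
    -- With r and c even, m ≡ 2 mod 4. If r = c then 4 divides e, and e ≠ 0 since 3 does not divide
    -- m; otherwise |f| ≥ 2. Either way the slack is at least 12.
    · simp only [Nat.odd_iff] at ho
      push Not at ho
      have hm2 : m % 3 ≠ 0 ∧ m ^ 2 % 12 = 4 := hm4.resolve_left (by omega)
      have h1 : 12 ≤ e ^ 2 + 3 * f ^ 2 := by
        by_cases hf2 : f = 0
        · have := big e 4 (by omega) (by norm_num)
          linarith
        · have := big f 2 (by omega) (by norm_num)
          linarith
      refine le_G_of_le_sq ?_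
      zify
      linarith
  -- Here e = 3 - m/2, so |e| ≥ 3 except for small m.
  have hde : d = 2 := by omega
  by_cases hsmall : 2 ≤ m ∧ m ≤ 10
  · have hmc : m = 2 ∨ m = 4 ∨ m = 8 := by omega
    rcases hmc with h | h | h
    · have : s = 0 := by omega
      subst this
      omega
    · have : s = 1 := by omega
      subst this
      rw [h]
      have : G 4 = 1 := rfl
      omega
    · have : s = 3 := by omega
      subst this
      rw [h]
      have : G 8 = 5 := rfl
      have : r = 0 ∨ r = 1 ∨ r = 2 ∨ r = 3 ∨ 4 ≤ r := by omega
      rcases this with h | h | h | h | h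
      all_goals omega
  · have hE : 3 ≤ e ∨ e ≤ -3 := by omega
    have h1 := big e 3 hE (by norm_num)
    have h2 : 12 * k ≤ m ^ 2 + 3 := by zify; linarith
    have h3 : m ^ 2 % 12 = 0 ∨ m ^ 2 % 12 = 4 := by
      rcases hm4 with h | h
      · left; (rw [hmsq, h]; norm_num)
      · exact .inr h.2
    exact le_G_of_le_sq (by omega)

/-! ### Lines of the board -/

/-- The column, the row, the diagonal and the antidiagonal of a square. -/
def lineCoord {n : ℕ} : Fin 4 → Square n → ℤ
  | 0, q => ((q.1 : ℕ) : ℤ)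
  | 1, q => ((q.2 : ℕ) : ℤ)
  | 2, q => ((q.1 : ℕ) : ℤ) - ((q.2 : ℕ) : ℤ)
  | 3, q => ((q.1 : ℕ) : ℤ) + ((q.2 : ℕ) : ℤ)

/-- The line of the board of the direction `i` with coordinate `c`. -/
def boardLine (n : ℕ) (i : Fin 4) (c : ℤ) : Finset (Square n) :=
  Finset.univ.filter fun q => lineCoord i q = c

theorem mem_boardLine {n : ℕ} {i : Fin 4} {c : ℤ} {q : Square n} :
    q ∈ boardLine n i c ↔ lineCoord i q = c := by
  simp [boardLine]

theorem mem_attackedSquares {n : ℕ} {Q : Finset (Square n)} {q : Square n} :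
    q ∈ attackedSquares Q ↔ ∃ p ∈ Q, ∃ i, lineCoord i p = lineCoord i q := by
  simp only [attackedSquares, Finset.mem_filter, Finset.mem_univ, true_and]
  refine exists_congr fun p => and_congr_right fun _ => ?_
  simp only [QueenAttacks, Fin.ext_iff]
  constructor
  · rintro (h | h | h | h)
    · exact ⟨0, by simp only [lineCoord, h]⟩
    · exact ⟨1, by simp only [lineCoord, h]⟩
    · exact ⟨3, h⟩
    · exact ⟨2, h⟩
  · rintro ⟨i, h⟩
    fin_cases i
    · exact .inl (Nat.cast_injective (R := ℤ) h)
    · exact .inr (.inl (Nat.cast_injective (R := ℤ) h))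
    · exact .inr (.inr (.inr h))
    · exact .inr (.inr (.inl h))

theorem square_ext {n : ℕ} {p q : Square n} (h1 : ((p.1 : ℕ) : ℤ) = ((q.1 : ℕ) : ℤ))
    (h2 : ((p.2 : ℕ) : ℤ) = ((q.2 : ℕ) : ℤ)) : p = q :=
  Prod.ext (Fin.ext (by exact_mod_cast h1)) (Fin.ext (by exact_mod_cast h2))

theorem exists_square {n : ℕ} {x y : ℤ} (hx : 0 ≤ x ∧ x < n) (hy : 0 ≤ y ∧ y < n) :
    ∃ q : Square n, ((q.1 : ℕ) : ℤ) = x ∧ ((q.2 : ℕ) : ℤ) = y :=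
  ⟨(⟨x.toNat, by omega⟩, ⟨y.toNat, by omega⟩), by simp only [Int.toNat_of_nonneg hx.1],
    by simp only [Int.toNat_of_nonneg hy.1]⟩

theorem card_column {n : ℕ} {c : ℤ} (h : 0 ≤ c ∧ c < n) : (boardLine n 0 c).card = n := by
  have : (boardLine n 0 c).card = (Finset.Icc (0 : ℤ) (n - 1)).card := by
    refine Finset.card_bij (fun q _ => ((q.2 : ℕ) : ℤ)) (fun q hq => ?_) (fun p hp q hq hpq => ?_)
      (fun y hy => ?_)
    · rw [Finset.mem_Icc]
      omega
    · rw [mem_boardLine] at hp hq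
      exact square_ext (hp.trans hq.symm) hpq
    · rw [Finset.mem_Icc] at hy
      obtain ⟨q, h1, h2⟩ := exists_square h (show 0 ≤ y ∧ y < n by omega)
      exact ⟨q, mem_boardLine.2 h1, h2⟩
  rw [this, Int.card_Icc]
  omega

theorem card_row {n : ℕ} {c : ℤ} (h : 0 ≤ c ∧ c < n) : (boardLine n 1 c).card = n := by
  have : (boardLine n 1 c).card = (Finset.Icc (0 : ℤ) (n - 1)).card := by
    refine Finset.card_bij (fun q _ => ((q.1 : ℕ) : ℤ)) (fun q hq => ?_) (fun p hp q hq hpq => ?_)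
      (fun y hy => ?_)
    · rw [Finset.mem_Icc]
      omega
    · rw [mem_boardLine] at hp hq
      exact square_ext hpq (hp.trans hq.symm)
    · rw [Finset.mem_Icc] at hy
      obtain ⟨q, h1, h2⟩ := exists_square (show 0 ≤ y ∧ y < n by omega) h
      exact ⟨q, mem_boardLine.2 h2, h1⟩
  rw [this, Int.card_Icc]
  omega

theorem card_diag (n : ℕ) (v : ℤ) : (boardLine n 2 v).card = (n - |v|).toNat := by
  have : (boardLine n 2 v).card = (Finset.Icc (max 0 v) (min (n - 1) (n - 1 + v))).card := by
    refine Finset.card_bij (fun q _ => ((q.1 : ℕ) : ℤ)) (fun q hq => ?_) (fun p hp q hq hpq => ?_)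
      (fun x hx => ?_)
    · simp only [mem_boardLine, lineCoord] at hq
      rw [Finset.mem_Icc]
      omega
    · simp only [mem_boardLine, lineCoord] at hp hq
      exact square_ext hpq (by omega)
    · rw [Finset.mem_Icc] at hx
      obtain ⟨q, h1, h2⟩ := exists_square (n := n) (x := x) (y := x - v) (by omega) (by omega)
      exact ⟨q, mem_boardLine.2 (by simp only [lineCoord]; omega), h1⟩
  rw [this, Int.card_Icc]
  rcases abs_cases v with h | h <;> omega

theorem card_antidiag (n : ℕ) (w : ℤ) : (boardLine n 3 w).card = (n - |w - (n - 1)|).toNat := by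
  have : (boardLine n 3 w).card = (Finset.Icc (max 0 (w - (n - 1))) (min (n - 1) w)).card := by
    refine Finset.card_bij (fun q _ => ((q.1 : ℕ) : ℤ)) (fun q hq => ?_) (fun p hp q hq hpq => ?_)
      (fun x hx => ?_)
    · simp only [mem_boardLine, lineCoord] at hq
      rw [Finset.mem_Icc]
      omega
    · simp only [mem_boardLine, lineCoord] at hp hq
      exact square_ext hpq (by omega)
    · rw [Finset.mem_Icc] at hx
      obtain ⟨q, h1, h2⟩ := exists_square (n := n) (x := x) (y := w - x) (by omega) (by omega)
      exact ⟨q, mem_boardLine.2 (by simp only [lineCoord]; omega), h1⟩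
  rw [this, Int.card_Icc]
  rcases abs_cases (w - (n - 1)) with h | h <;> omega

theorem card_boardLine_inter_le (n : ℕ) {i j : Fin 4} {c e : ℤ} (h : ¬ (i = j ∧ c = e)) :
    (boardLine n i c ∩ boardLine n j e).card ≤ 1 := by
  rw [Finset.card_le_one]
  intro p hp q hq
  simp only [Finset.mem_inter, mem_boardLine] at hp hq
  obtain ⟨h1, h2⟩ := hp
  obtain ⟨h3, h4⟩ := hq
  fin_cases i <;> fin_cases j <;> simp [lineCoord] at h h1 h2 h3 h4 <;>
    first
    | omega
    | exact square_ext (by omega) (by omega)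

/-! ### The lower bound by summing over strips -/

/-- Lines that meet pairwise in at most one point: their union is almost as large as their sum. -/
theorem sum_card_le_card_biUnion_add_sq {ι α : Type*} [DecidableEq ι] [DecidableEq α]
    (L : ι → Finset α) (h : ∀ i j, i ≠ j → (L i ∩ L j).card ≤ 1) (T : Finset ι) :
    ∑ i ∈ T, (L i).card ≤ (T.biUnion L).card + T.card ^ 2 := by
  induction T using Finset.induction_on with
  | empty => simp
  | insert a T ha ih =>
    rw [Finset.sum_insert ha, Finset.biUnion_insert, Finset.card_insert_of_notMem ha]
    have h1 := Finset.card_union_add_card_inter (L a) (T.biUnion L)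
    have h2 : (L a ∩ T.biUnion L).card ≤ T.card := by
      rw [Finset.inter_biUnion]
      refine le_trans Finset.card_biUnion_le ?_
      refine le_trans (Finset.sum_le_card_nsmul _ _ 1 fun i hi => h a i ?_) (by simp)
      rintro rfl
      exact ha hi
    have h3 : (T.card + 1) ^ 2 = T.card ^ 2 + 2 * T.card + 1 := by ring
    omega

/-- The `m` elements of `D` with the greatest values of `l`. -/
theorem exists_subset_greatest {α : Type*} [DecidableEq α] (l : α → ℤ) (m : ℕ) :
    ∀ D : Finset α, ∃ E ⊆ D, E.card ≤ m ∧
      ∀ t, min m (D.filter fun v => t ≤ l v).card ≤ (E.filter fun v => t ≤ l v).card := by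
  induction m with
  | zero => exact fun D => ⟨∅, by simp, by simp, by simp⟩
  | succ m ih =>
    intro D
    rcases D.eq_empty_or_nonempty with rfl | hD
    · exact ⟨∅, by simp, by simp, by simp⟩
    obtain ⟨x, hx, hmax⟩ := D.exists_max_image l hD
    obtain ⟨E, hE, hc, ht⟩ := ih (D.erase x)
    have hxE : x ∉ E := fun h => Finset.notMem_erase x D (hE h)
    refine ⟨insert x E, ?_, ?_, fun t => ?_⟩
    · exact Finset.insert_subset hx (hE.trans (Finset.erase_subset _ _))
    · rw [Finset.card_insert_of_notMem hxE]; omega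
    · by_cases htx : t ≤ l x
      · have h1 := ht t
        have h2 : (D.filter fun v => t ≤ l v) = insert x ((D.erase x).filter fun v => t ≤ l v) := by
          rw [← Finset.insert_erase hx, Finset.filter_insert, if_pos htx, Finset.insert_erase hx]
        rw [h2, Finset.card_insert_of_notMem (by simp), Finset.filter_insert, if_pos htx,
          Finset.card_insert_of_notMem (by simp [hxE])]
        omega
      · have : (D.filter fun v => t ≤ l v) = ∅ :=
          Finset.filter_eq_empty_iff.2 fun v hv h => htx (h.trans (hmax v hv))
        rw [this]
        simp

/-- Centering the board gives a covered set for each choice of strips. -/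
theorem card_le_G_of_strips {n : ℕ} (Q : Finset (Square n)) (t : ℤ) :
    Q.card ≤ G ((Q.image (lineCoord 0)).card + (Q.image (lineCoord 1)).card +
      (((Q.image (lineCoord 2)).filter fun v : ℤ => t ≤ n - |v|).card +
        ((Q.image (lineCoord 3)).filter fun w : ℤ => n + 1 - t ≤ n - |w - (n - 1)|).card)) := by
  have i1 : Function.Injective fun x : ℤ => 2 * x - (n - 1) := fun x y h => by
    dsimp only at h; omega
  have i2 : Function.Injective fun x : ℤ => 2 * x := fun x y h => by dsimp only at h; omega
  have i3 : Function.Injective fun x : ℤ => 2 * (x - (n - 1)) := fun x y h => by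
    dsimp only at h; omega
  have i4 : Function.Injective fun q : Square n =>
      ((2 * lineCoord 0 q - (n - 1), 2 * lineCoord 1 q - (n - 1)) : ℤ × ℤ) := fun p q h => by
    simp only [Prod.mk.injEq, lineCoord] at h
    exact square_ext (by omega) (by omega)
  -- Coordinates are doubled because the centre of the board may be a half-integer point. The
  -- half-widths n - t and t - 1 add up to n - 1.
  have key : StripCovered (Q.image fun q => (2 * lineCoord 0 q - (n - 1), 2 * lineCoord 1 q - (n - 1)))
      ((Q.image (lineCoord 0)).image fun x => 2 * x - (n - 1))
      ((Q.image (lineCoord 1)).image fun x => 2 * x - (n - 1))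
      (((Q.image (lineCoord 2)).filter fun v : ℤ => t ≤ n - |v|).image fun x => 2 * x)
      (((Q.image (lineCoord 3)).filter fun w : ℤ => n + 1 - t ≤ n - |w - (n - 1)|).image
        fun x : ℤ => 2 * (x - (n - 1))) (n - 1) (n - t) (t - 1) := by
    have dm : ∀ q ∈ Q, t ≤ n - |lineCoord 2 q| → (2 * lineCoord 0 q - (n - 1)) -
        (2 * lineCoord 1 q - (n - 1)) ∈
        ((Q.image (lineCoord 2)).filter fun v : ℤ => t ≤ n - |v|).image fun x => 2 * x := by
      intro q hq h
      refine Finset.mem_image.2 ⟨lineCoord 2 q, Finset.mem_filter.2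
        ⟨Finset.mem_image_of_mem _ hq, h⟩, ?_⟩
      simp only [lineCoord]
      ring
    have am : ∀ q ∈ Q, n + 1 - t ≤ n - |lineCoord 3 q - (n - 1)| → (2 * lineCoord 0 q - (n - 1)) +
        (2 * lineCoord 1 q - (n - 1)) ∈
        ((Q.image (lineCoord 3)).filter fun w : ℤ => n + 1 - t ≤ n - |w - (n - 1)|).image
          fun x : ℤ => 2 * (x - (n - 1)) := by
      intro q hq h
      refine Finset.mem_image.2 ⟨lineCoord 3 q, Finset.mem_filter.2
        ⟨Finset.mem_image_of_mem _ hq, h⟩, ?_⟩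
      simp only [lineCoord]
      ring
    refine ⟨⟨fun p hp => ?_, fun p hp => ?_⟩, by ring, fun x hx => ?_, fun y hy => ?_,
      fun v hv => ?_, fun u hu => ?_, fun p hp h => ?_, fun p hp h => ?_⟩
    · obtain ⟨q, hq, rfl⟩ := Finset.mem_image.1 hp
      exact ⟨Finset.mem_image_of_mem _ (Finset.mem_image_of_mem _ hq),
        Finset.mem_image_of_mem _ (Finset.mem_image_of_mem _ hq)⟩
    · obtain ⟨q, hq, rfl⟩ := Finset.mem_image.1 hp
      by_cases h : t ≤ n - |lineCoord 2 q|
      · exact .inl (dm q hq h)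
      -- On the board, |x - y| + |x + y - (n - 1)| ≤ n - 1.
      · refine .inr (am q hq ?_)
        simp only [lineCoord] at h ⊢
        rcases abs_cases (((q.1 : ℕ) : ℤ) - ((q.2 : ℕ) : ℤ)) with h1 | h1 <;>
        rcases abs_cases (((q.1 : ℕ) : ℤ) + ((q.2 : ℕ) : ℤ) - (n - 1)) with h2 | h2 <;> omega
    · obtain ⟨c, hc, rfl⟩ := Finset.mem_image.1 hx
      obtain ⟨q, hq, rfl⟩ := Finset.mem_image.1 hc
      simp only [lineCoord]
      rw [abs_le]
      omega
    · obtain ⟨c, hc, rfl⟩ := Finset.mem_image.1 hy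
      obtain ⟨q, hq, rfl⟩ := Finset.mem_image.1 hc
      simp only [lineCoord]
      rw [abs_le]
      omega
    · obtain ⟨c, hc, rfl⟩ := Finset.mem_image.1 hv
      have h1 := (Finset.mem_filter.1 hc).2
      rw [abs_mul, abs_two]
      omega
    · obtain ⟨c, hc, rfl⟩ := Finset.mem_image.1 hu
      have h1 := (Finset.mem_filter.1 hc).2
      rw [abs_mul, abs_two]
      omega
    · obtain ⟨q, hq, rfl⟩ := Finset.mem_image.1 hp
      refine dm q hq ?_
      simp only [lineCoord] at h ⊢
      rw [abs_le] at h
      rcases abs_cases (((q.1 : ℕ) : ℤ) - ((q.2 : ℕ) : ℤ)) with h1 | h1 <;> omega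
    · obtain ⟨q, hq, rfl⟩ := Finset.mem_image.1 hp
      refine am q hq ?_
      simp only [lineCoord] at h ⊢
      rw [abs_le] at h
      rcases abs_cases (((q.1 : ℕ) : ℤ) + ((q.2 : ℕ) : ℤ) - (n - 1)) with h1 | h1 <;> omega
  have h := key.card_le_G
  rwa [Finset.card_image_of_injective _ i1, Finset.card_image_of_injective _ i1,
    Finset.card_image_of_injective _ i2, Finset.card_image_of_injective _ i3,
    Finset.card_image_of_injective _ i4] at h

/-- Double counting: with f the length, summing over thresholds counts a line at most as often as
its length. -/
theorem sum_card_filter_le {α : Type*} (E : Finset α) (T : Finset ℤ) (P : ℤ → α → Prop)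
    [∀ t v, Decidable (P t v)] (f : α → ℕ) (h : ∀ v ∈ E, (T.filter fun t => P t v).card ≤ f v) :
    ∑ t ∈ T, (E.filter fun v => P t v).card ≤ ∑ v ∈ E, f v := by
  simp only [Finset.card_filter]
  rw [Finset.sum_comm]
  refine Finset.sum_le_sum fun v hv => ?_
  rw [← Finset.card_filter]
  exact h v hv

/-- The lower bound for the number of attacked squares. -/
theorem mul_le_card_attackedSquares_add {n m : ℕ} (Q : Finset (Square n))
    (hm : ∀ j, Q.card ≤ G j → m ≤ j) :
    m * n ≤ (attackedSquares Q).card + 16 * m ^ 2 := by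
  -- At most m lines of each direction are kept, so that overlaps cost O(m²). All columns and all
  -- rows have equal length, hence the constant weight.
  obtain ⟨R, hR, hRc, hRt⟩ := exists_subset_greatest (fun _ => 0) m (Q.image (lineCoord 0))
  obtain ⟨C, hC, hCc, hCt⟩ := exists_subset_greatest (fun _ => 0) m (Q.image (lineCoord 1))
  obtain ⟨D, hD, hDc, hDt⟩ := exists_subset_greatest (fun v : ℤ => n - |v|) m
    (Q.image (lineCoord 2))
  obtain ⟨A, hA, hAc, hAt⟩ := exists_subset_greatest (fun w : ℤ => n - |w - (n - 1)|) m
    (Q.image (lineCoord 3))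
  have hR0 := hRt 0
  have hC0 := hCt 0
  simp only [le_refl, Finset.filter_true] at hR0 hC0
  -- Either one of the truncated counts is already m, or nothing was cut off and the bound by G
  -- applies.
  have step : ∀ t ∈ Finset.Icc (1 : ℤ) n, m ≤ R.card + C.card +
      ((D.filter fun v : ℤ => t ≤ n - |v|).card +
        (A.filter fun w : ℤ => n + 1 - t ≤ n - |w - (n - 1)|).card) := by
    intro t _
    have h1 := hm _ (card_le_G_of_strips Q t)
    have h2 := hDt t
    have h3 := hAt (n + 1 - t)
    omega
  have hsum := Finset.sum_le_sum step
  simp only [Finset.sum_add_distrib, Finset.sum_const, Int.card_Icc] at hsum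
  have sD := sum_card_filter_le D (Finset.Icc (1 : ℤ) n) (fun t v => t ≤ n - |v|)
    (fun v => (boardLine n 2 v).card) (fun v _ => by
      rw [card_diag]
      refine le_trans (Finset.card_le_card (t := Finset.Icc 1 (n - |v|)) fun t ht => ?_) ?_
      · simp only [Finset.mem_filter, Finset.mem_Icc] at ht ⊢
        omega
      · rw [Int.card_Icc]
        omega)
  have sA := sum_card_filter_le A (Finset.Icc (1 : ℤ) n) (fun t w => n + 1 - t ≤ n - |w - (n - 1)|)
    (fun w => (boardLine n 3 w).card) (fun w _ => by
      rw [card_antidiag]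
      refine le_trans (Finset.card_le_card
        (t := Finset.Icc (n + 1 - (n - |w - (n - 1)|)) n) fun t ht => ?_) ?_
      · simp only [Finset.mem_filter, Finset.mem_Icc] at ht ⊢
        omega
      · rw [Int.card_Icc]
        omega)
  have sR : ∑ c ∈ R, (boardLine n 0 c).card = R.card * n := by
    rw [Finset.sum_congr rfl fun c hc => card_column (n := n) ?_, Finset.sum_const, smul_eq_mul]
    obtain ⟨q, -, rfl⟩ := Finset.mem_image.1 (hR hc)
    simp only [lineCoord]
    omega
  have sC : ∑ c ∈ C, (boardLine n 1 c).card = C.card * n := by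
    rw [Finset.sum_congr rfl fun c hc => card_row (n := n) ?_, Finset.sum_const, smul_eq_mul]
    obtain ⟨q, -, rfl⟩ := Finset.mem_image.1 (hC hc)
    simp only [lineCoord]
    omega
  obtain ⟨F, hF⟩ : ∃ F : Fin 4 → Finset ℤ, F = ![R, C, D, A] := ⟨_, rfl⟩
  have hsub : ((Finset.univ : Finset (Fin 4)).sigma F).biUnion
      (fun x => boardLine n x.1 x.2) ⊆ attackedSquares Q := by
    intro q hq
    obtain ⟨⟨i, c⟩, h1, h2⟩ := Finset.mem_biUnion.1 hq
    have h3 := (Finset.mem_sigma.1 h1).2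
    rw [mem_boardLine] at h2
    rw [mem_attackedSquares]
    have h4 : c ∈ Q.image (lineCoord i) := by
      rw [hF] at h3
      fin_cases i
      · exact hR h3
      · exact hC h3
      · exact hD h3
      · exact hA h3
    obtain ⟨p, hp, h5⟩ := Finset.mem_image.1 h4
    exact ⟨p, hp, i, h5.trans h2.symm⟩
  -- At most 4m lines are involved, whence the error (4m)² = 16m².
  have hbon := sum_card_le_card_biUnion_add_sq
    (fun x : (_ : Fin 4) × ℤ => boardLine n x.1 x.2) (fun x y hxy => by
      refine card_boardLine_inter_le n fun h => hxy ?_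
      exact Sigma.ext h.1 (heq_of_eq h.2)) ((Finset.univ : Finset (Fin 4)).sigma F)
  rw [Finset.sum_sigma, Finset.card_sigma, Fin.sum_univ_four, Fin.sum_univ_four] at hbon
  have f0 : F 0 = R := by rw [hF]; rfl
  have f1 : F 1 = C := by rw [hF]; rfl
  have f2 : F 2 = D := by rw [hF]; rfl
  have f3 : F 3 = A := by rw [hF]; rfl
  rw [f0, f1, f2, f3, sR, sC] at hbon
  have h1 := Finset.card_le_card hsub
  have h2 : (R.card + C.card + D.card + A.card) ^ 2 ≤ (4 * m) ^ 2 :=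
    Nat.pow_le_pow_left (by omega) 2
  have h3 : ((n : ℤ) + 1 - 1).toNat = n := by omega
  simp only [h3, smul_eq_mul] at hsum
  dsimp only at hbon
  nlinarith

/-! ### Placements for the upper bound -/

theorem attackedSquares_mono {n : ℕ} {Q Q' : Finset (Square n)} (h : Q ⊆ Q') :
    attackedSquares Q ⊆ attackedSquares Q' := by
  intro q hq
  rw [mem_attackedSquares] at hq ⊢
  obtain ⟨p, hp, h1⟩ := hq
  exact ⟨p, h hp, h1⟩

theorem card_column_le (n : ℕ) (c : ℤ) : (boardLine n 0 c).card ≤ n := by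
  rcases (boardLine n 0 c).eq_empty_or_nonempty with h | ⟨q, hq⟩
  · simp [h]
  · rw [mem_boardLine] at hq
    simp only [lineCoord] at hq
    exact (card_column (by omega)).le

theorem card_row_le (n : ℕ) (c : ℤ) : (boardLine n 1 c).card ≤ n := by
  rcases (boardLine n 1 c).eq_empty_or_nonempty with h | ⟨q, hq⟩
  · simp [h]
  · rw [mem_boardLine] at hq
    simp only [lineCoord] at hq
    exact (card_row (by omega)).le

theorem card_diag_le (n : ℕ) (c : ℤ) : (boardLine n 2 c).card ≤ n := by
  rw [card_diag]
  have := abs_nonneg c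
  omega

theorem card_antidiag_le (n : ℕ) (c : ℤ) : (boardLine n 3 c).card ≤ n := by
  rw [card_antidiag]
  have := abs_nonneg (c - (n - 1))
  omega

/-- The indices within distance `K` of one of the two sides of the board. -/
def sideIndices (n K : ℕ) : Finset (Fin n) :=
  Finset.univ.filter fun i : Fin n => (i : ℕ) < K ∨ n ≤ (i : ℕ) + K

theorem card_sideIndices_le (n K : ℕ) : (sideIndices n K).card ≤ 2 * K := by
  have h : sideIndices n K ⊆ (Finset.univ.filter fun i : Fin n => (i : ℕ) < K) ∪
      (Finset.univ.filter fun i : Fin n => n ≤ (i : ℕ) + K) := by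
    intro i
    simp [sideIndices]
  have h1 : (Finset.univ.filter fun i : Fin n => (i : ℕ) < K).card ≤ (Finset.range K).card :=
    Finset.card_le_card_of_injOn (fun i => (i : ℕ)) (fun i hi => by simpa using hi)
      (fun i _ j _ hij => Fin.ext hij)
  have h2 : (Finset.univ.filter fun i : Fin n => n ≤ (i : ℕ) + K).card ≤ (Finset.range K).card :=
    Finset.card_le_card_of_injOn (fun i => n - 1 - (i : ℕ))
      (fun i hi => by
        simp only [Finset.coe_filter, Finset.mem_univ, true_and, Set.mem_ofPred_eq] at hi
        simp only [Finset.coe_range, Set.mem_Iio]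
        omega)
      (fun i _ j _ hij => Fin.ext (by dsimp only at hij; omega))
  rw [Finset.card_range] at h1 h2
  have h3 := Finset.card_le_card h
  have h4 := Finset.card_union_le (Finset.univ.filter fun i : Fin n => (i : ℕ) < K)
      (Finset.univ.filter fun i : Fin n => n ≤ (i : ℕ) + K)
  omega

/-- Queens on given columns and rows, and on given diagonals or on short ones. -/
theorem card_attackedSquares_le {n K : ℕ} {Q : Finset (Square n)} {R C D A : Finset ℤ}
    (hR : ∀ p ∈ Q, lineCoord 0 p ∈ R) (hC : ∀ p ∈ Q, lineCoord 1 p ∈ C)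
    (hD : ∀ p ∈ Q, lineCoord 2 p ∈ D ∨ (n : ℤ) - K ≤ |lineCoord 2 p|)
    (hA : ∀ p ∈ Q, lineCoord 3 p ∈ A ∨ (n : ℤ) - K ≤ |lineCoord 3 p - (n - 1)|) :
    (attackedSquares Q).card ≤ (R.card + C.card) * n + ∑ v ∈ D, (boardLine n 2 v).card +
      ∑ w ∈ A, (boardLine n 3 w).card + 4 * K ^ 2 := by
  -- A diagonal or antidiagonal of length at most K stays within K of two sides at a corner, so all
  -- of these fit in the four K × K corner squares.
  have hsub : attackedSquares Q ⊆ R.biUnion (boardLine n 0) ∪ C.biUnion (boardLine n 1) ∪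
      D.biUnion (boardLine n 2) ∪ A.biUnion (boardLine n 3) ∪
      sideIndices n K ×ˢ sideIndices n K := by
    intro q hq
    rw [mem_attackedSquares] at hq
    obtain ⟨p, hp, i, hi⟩ := hq
    simp only [Finset.mem_union, Finset.mem_biUnion, mem_boardLine]
    fin_cases i
    · exact .inl (.inl (.inl (.inl ⟨_, hR p hp, hi.symm⟩)))
    · exact .inl (.inl (.inl (.inr ⟨_, hC p hp, hi.symm⟩)))
    · rcases hD p hp with h | h
      · exact .inl (.inl (.inr ⟨_, h, hi.symm⟩))
      · right
        change lineCoord 2 p = lineCoord 2 q at hi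
        rw [hi] at h
        simp only [lineCoord] at h
        simp only [Finset.mem_product, sideIndices, Finset.mem_filter, Finset.mem_univ, true_and]
        rcases abs_cases (((q.1 : ℕ) : ℤ) - ((q.2 : ℕ) : ℤ)) with h1 | h1 <;> omega
    · rcases hA p hp with h | h
      · exact .inl (.inr ⟨_, h, hi.symm⟩)
      · right
        change lineCoord 3 p = lineCoord 3 q at hi
        rw [hi] at h
        simp only [lineCoord] at h
        simp only [Finset.mem_product, sideIndices, Finset.mem_filter, Finset.mem_univ, true_and]
        rcases abs_cases (((q.1 : ℕ) : ℤ) + ((q.2 : ℕ) : ℤ) - (n - 1)) with h1 | h1 <;> omega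
  refine (Finset.card_le_card hsub).trans ?_
  refine (Finset.card_union_le _ _).trans ?_
  refine Nat.add_le_add ?_ ?_
  · refine (Finset.card_union_le _ _).trans (Nat.add_le_add ?_ Finset.card_biUnion_le)
    refine (Finset.card_union_le _ _).trans (Nat.add_le_add ?_ Finset.card_biUnion_le)
    refine (Finset.card_union_le _ _).trans ?_
    rw [add_mul]
    exact Nat.add_le_add (Finset.card_biUnion_le_card_mul _ _ _ fun c _ => card_column_le n c)
      (Finset.card_biUnion_le_card_mul _ _ _ fun c _ => card_row_le n c)
  · rw [Finset.card_product]
    have h := card_sideIndices_le n K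
    calc _ ≤ (2 * K) * (2 * K) := Nat.mul_le_mul h h
      _ = 4 * K ^ 2 := by ring

/-- A square grid without the first `α` and the last `β` of its diagonals. -/
def hexagon (w α β : ℕ) : Finset (Fin w × Fin w) :=
  Finset.univ.filter fun p => (p.2 : ℕ) + 1 + α ≤ w + p.1 ∧ (p.1 : ℕ) + 1 + β ≤ w + p.2

theorem two_mul_card_sigma_antidiagonal (α : ℕ) :
    2 * ((Finset.range α).sigma fun s => Finset.HasAntidiagonal.antidiagonal s).card = α * (α + 1) := by
  rw [Finset.card_sigma]
  induction α with
  | zero => simp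
  | succ α ih =>
    rw [Finset.sum_range_succ, mul_add, ih, Finset.Nat.card_antidiagonal]
    ring

/-- The two corners cut off are triangles with α(α + 1)/2 and β(β + 1)/2 squares; doubling avoids
the division. -/
theorem two_mul_sq_le_card_hexagon (w α β : ℕ) :
    2 * w ^ 2 ≤ 2 * (hexagon w α β).card + α * (α + 1) + β * (β + 1) := by
  have hsub : (Finset.univ : Finset (Fin w × Fin w)) ⊆ hexagon w α β ∪
      (Finset.univ.filter fun p : Fin w × Fin w => (p.1 : ℕ) + (w - 1 - p.2) < α) ∪
      (Finset.univ.filter fun p : Fin w × Fin w => (w - 1 - p.1) + (p.2 : ℕ) < β) := by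
    intro p _
    simp only [hexagon, Finset.mem_union, Finset.mem_filter, Finset.mem_univ, true_and]
    omega
  have h1 := Finset.card_le_card hsub
  have h2 := Finset.card_union_le (hexagon w α β ∪
      (Finset.univ.filter fun p : Fin w × Fin w => (p.1 : ℕ) + (w - 1 - p.2) < α))
      (Finset.univ.filter fun p : Fin w × Fin w => (w - 1 - p.1) + (p.2 : ℕ) < β)
  have h3 := Finset.card_union_le (hexagon w α β)
      (Finset.univ.filter fun p : Fin w × Fin w => (p.1 : ℕ) + (w - 1 - p.2) < α)
  have h4 : (Finset.univ.filter fun p : Fin w × Fin w => (p.1 : ℕ) + (w - 1 - p.2) < α).card ≤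
      ((Finset.range α).sigma fun s => Finset.HasAntidiagonal.antidiagonal s).card := by
    refine Finset.card_le_card_of_injOn
      (fun p => ⟨(p.1 : ℕ) + (w - 1 - p.2), ((p.1 : ℕ), w - 1 - p.2)⟩) (fun p hp => ?_)
      (fun p _ q _ hpq => ?_)
    · simpa using hp
    · simp only [Sigma.mk.injEq] at hpq
      have h5 := Prod.ext_iff.1 (eq_of_heq hpq.2)
      dsimp only at h5
      exact Prod.ext (Fin.ext (by omega)) (Fin.ext (by omega))
  have h5 : (Finset.univ.filter fun p : Fin w × Fin w => (w - 1 - p.1) + (p.2 : ℕ) < β).card ≤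
      ((Finset.range β).sigma fun s => Finset.HasAntidiagonal.antidiagonal s).card := by
    refine Finset.card_le_card_of_injOn
      (fun p => ⟨(w - 1 - p.1) + (p.2 : ℕ), (w - 1 - p.1, (p.2 : ℕ))⟩) (fun p hp => ?_)
      (fun p _ q _ hpq => ?_)
    · simpa using hp
    · simp only [Sigma.mk.injEq] at hpq
      have h5 := Prod.ext_iff.1 (eq_of_heq hpq.2)
      dsimp only at h5
      exact Prod.ext (Fin.ext (by omega)) (Fin.ext (by omega))
  have h6 := two_mul_card_sigma_antidiagonal α
  have h7 := two_mul_card_sigma_antidiagonal β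
  rw [Finset.card_univ, Fintype.card_prod, Fintype.card_fin, ← pow_two] at h1
  omega

/-- A hexagon in a corner of the board. -/
theorem exists_corner_placement {n w : ℕ} (α β δ : ℕ) (hw : w ≤ n) (hδ : 2 * w ≤ 1 + α + β + δ) :
    ∃ Q : Finset (Square n), Q.card = (hexagon w α β).card ∧
      (attackedSquares Q).card ≤ (2 * w + δ) * n + 16 * w ^ 2 := by
  have hinj : Function.Injective fun p : Fin w × Fin w =>
      ((Fin.castLE hw p.1, Fin.castLE hw p.2) : Square n) := fun p q h => by
    simp only [Prod.mk.injEq, Fin.ext_iff, Fin.val_castLE] at h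
    exact Prod.ext (Fin.ext h.1) (Fin.ext h.2)
  refine ⟨(hexagon w α β).image fun p => (Fin.castLE hw p.1, Fin.castLE hw p.2),
    Finset.card_image_of_injective _ hinj, ?_⟩
  -- All antidiagonals of the hexagon are shorter than 2w, so `A` may be empty.
  have h := card_attackedSquares_le (n := n) (K := 2 * w)
    (Q := (hexagon w α β).image fun p => (Fin.castLE hw p.1, Fin.castLE hw p.2))
    (R := Finset.Icc (0 : ℤ) (w - 1)) (C := Finset.Icc (0 : ℤ) (w - 1))
    (D := Finset.Icc ((1 : ℤ) + α - w) (w - 1 - β)) (A := ∅) ?_ ?_ ?_ ?_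
  · have h1 : (∑ v ∈ Finset.Icc ((1 : ℤ) + α - w) (w - 1 - β), (boardLine n 2 v).card) ≤ δ * n := by
      refine (Finset.sum_le_card_nsmul _ _ n fun v _ => card_diag_le n v).trans ?_
      rw [smul_eq_mul, Int.card_Icc]
      exact Nat.mul_le_mul_right n (by omega)
    rw [Int.card_Icc, Finset.sum_empty, show ((w : ℤ) - 1 + 1 - 0).toNat = w by omega] at h
    have h2 : 4 * (2 * w) ^ 2 = 16 * w ^ 2 := by ring
    have h3 : (2 * w + δ) * n = (w + w) * n + δ * n := by ring
    omega
  all_goals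
    intro p hp
    obtain ⟨q, hq, rfl⟩ := Finset.mem_image.1 hp
    have h1 := (Finset.mem_filter.1 hq).2
    simp only [lineCoord, Fin.val_castLE, Finset.mem_Icc]
  · omega
  · omega
  · left
    omega
  · right
    rcases abs_cases (((q.1 : ℕ) : ℤ) + ((q.2 : ℕ) : ℤ) - (n - 1)) with h1 | h1 <;> omega

/-- Four hexagons in the corners of the board that share their lines. -/
theorem exists_four_corner_placement {n : ℕ} (q : ℕ) (hn : 2 * (2 * q + 1) ≤ n) :
    ∃ Q : Finset (Square n), Q.card = 4 * (hexagon (2 * q + 1) q q).card ∧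
      (attackedSquares Q).card ≤ (12 * q + 6) * n + 16 * (2 * q + 1) ^ 2 := by
  obtain ⟨w, hw⟩ : ∃ w, w = 2 * q + 1 := ⟨_, rfl⟩
  rw [← hw] at hn ⊢
  have hwn : w ≤ n := by omega
  obtain ⟨e, he⟩ : ∃ e : Bool → Fin w → Fin n,
      e = fun b i => if b then Fin.rev (Fin.castLE hwn i) else Fin.castLE hwn i := ⟨_, rfl⟩
  have he0 : ∀ i, ((e false i : ℕ) : ℤ) = i := fun i => by rw [he]; simp
  have he1 : ∀ i, ((e true i : ℕ) : ℤ) = n - 1 - i := fun i => by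
    rw [he]
    simp only [if_true, Fin.val_rev, Fin.val_castLE]
    omega
  have hinj : Function.Injective fun x : (Bool × Bool) × (Fin w × Fin w) =>
      ((e x.1.1 x.2.1, e x.1.2 x.2.2) : Square n) := by
    have key : ∀ b c i j, e b i = e c j → b = c ∧ i = j := by
      intro b c i j h
      have h1 : ((e b i : ℕ) : ℤ) = ((e c j : ℕ) : ℤ) := by rw [h]
      cases b <;> cases c <;> simp only [he0, he1] at h1
      · exact ⟨rfl, Fin.ext (by omega)⟩
      · omega
      · omega
      · exact ⟨rfl, Fin.ext (by omega)⟩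
    rintro ⟨⟨b, c⟩, i, j⟩ ⟨⟨b', c'⟩, i', j'⟩ h
    simp only [Prod.mk.injEq] at h ⊢
    have h1 := key _ _ _ _ h.1
    have h2 := key _ _ _ _ h.2
    exact ⟨⟨h1.1, h2.1⟩, h1.2, h2.2⟩
  refine ⟨((Finset.univ : Finset (Bool × Bool)) ×ˢ hexagon w q q).image
    fun x => (e x.1.1 x.2.1, e x.1.2 x.2.2), ?_, ?_⟩
  · rw [Finset.card_image_of_injective _ hinj, Finset.card_product]
    rfl
  -- Opposite corners share the w = 2q + 1 central diagonals or antidiagonals, and lines of the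
  -- other direction are short. With 2w columns and 2w rows this makes 6w = 12q + 6 lines.
  have h := card_attackedSquares_le (n := n) (K := 2 * w)
    (Q := ((Finset.univ : Finset (Bool × Bool)) ×ˢ hexagon w q q).image
      fun x => (e x.1.1 x.2.1, e x.1.2 x.2.2))
    (R := Finset.Icc (0 : ℤ) (w - 1) ∪ Finset.Icc (n - w : ℤ) (n - 1))
    (C := Finset.Icc (0 : ℤ) (w - 1) ∪ Finset.Icc (n - w : ℤ) (n - 1))
    (D := Finset.Icc (-q : ℤ) q) (A := Finset.Icc (n - 1 - q : ℤ) (n - 1 + q)) ?_ ?_ ?_ ?_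
  · have h1 : (∑ v ∈ Finset.Icc (-q : ℤ) q, (boardLine n 2 v).card) ≤ w * n := by
      refine (Finset.sum_le_card_nsmul _ _ n fun v _ => card_diag_le n v).trans ?_
      rw [smul_eq_mul, Int.card_Icc]
      exact Nat.mul_le_mul_right n (by omega)
    have h2 : (∑ v ∈ Finset.Icc (n - 1 - q : ℤ) (n - 1 + q), (boardLine n 3 v).card) ≤ w * n := by
      refine (Finset.sum_le_card_nsmul _ _ n fun v _ => card_antidiag_le n v).trans ?_
      rw [smul_eq_mul, Int.card_Icc]
      exact Nat.mul_le_mul_right n (by omega)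
    have h3 := Finset.card_union_le (Finset.Icc (0 : ℤ) (w - 1)) (Finset.Icc (n - w : ℤ) (n - 1))
    rw [Int.card_Icc, Int.card_Icc] at h3
    have h4 : (12 * q + 6) * n = (2 * w + 2 * w) * n + w * n + w * n := by rw [hw]; ring
    have h5 : 4 * (2 * w) ^ 2 = 16 * w ^ 2 := by ring
    have h6 := Nat.mul_le_mul_right n (Nat.add_le_add (show (Finset.Icc (0 : ℤ) (w - 1) ∪
      Finset.Icc (n - w : ℤ) (n - 1)).card ≤ 2 * w by omega) (show (Finset.Icc (0 : ℤ) (w - 1) ∪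
      Finset.Icc (n - w : ℤ) (n - 1)).card ≤ 2 * w by omega))
    omega
  all_goals
    intro p hp
    obtain ⟨⟨⟨b, c⟩, i, j⟩, hx, rfl⟩ := Finset.mem_image.1 hp
    have h1 := (Finset.mem_filter.1 (Finset.mem_product.1 hx).2).2
    dsimp only at h1
    simp only [lineCoord, Finset.mem_Icc, Finset.mem_union]
  · cases b <;> simp only [he0, he1] <;> omega
  · cases c <;> simp only [he0, he1] <;> omega
  · cases b <;> cases c <;> simp only [he0, he1]
    · left; omega
    · right
      refine le_trans ?_ (neg_le_abs _)
      omega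
    · right
      refine le_trans ?_ (le_abs_self _)
      omega
    · left; omega
  · cases b <;> cases c <;> simp only [he0, he1]
    · right
      refine le_trans ?_ (neg_le_abs _)
      omega
    · left; omega
    · left; omega
    · right
      refine le_trans ?_ (le_abs_self _)
      omega

/-- Nine queens on the corners, near the midpoints of the edges and near the centre. -/
theorem exists_nine_placement {n : ℕ} (hn : 20 ≤ n) :
    ∃ Q : Finset (Square n), Q.card = 9 ∧ (attackedSquares Q).card ≤ 10 * n + 40 := by
  obtain ⟨h, hh⟩ : ∃ h, h = (n - 1) / 2 := ⟨_, rfl⟩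
  obtain ⟨e, he⟩ : ∃ e : Fin 3 → Fin n, ∀ i, ((e i : ℕ) : ℤ) = i * h :=
    ⟨fun i => ⟨i * h, by fin_cases i <;> simp <;> omega⟩, fun i => by simp⟩
  have hinj : Function.Injective fun p : Fin 3 × Fin 3 => ((e p.1, e p.2) : Square n) := by
    have key : ∀ i j, e i = e j → i = j := by
      intro i j hij
      have h1 : ((i : ℕ) : ℤ) * h = (j : ℕ) * h := by rw [← he, ← he, hij]
      have h2 := mul_right_cancel₀ (show (h : ℤ) ≠ 0 by omega) h1
      exact Fin.ext (by exact_mod_cast h2)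
    rintro ⟨i, j⟩ ⟨i', j'⟩ hp
    simp only [Prod.mk.injEq] at hp
    exact Prod.ext (key _ _ hp.1) (key _ _ hp.2)
  refine ⟨(Finset.univ : Finset (Fin 3 × Fin 3)).image fun p => (e p.1, e p.2), ?_, ?_⟩
  · rw [Finset.card_image_of_injective _ hinj]
    rfl
  have he' : ((e 0 : ℕ) : ℤ) = 0 ∧ ((e 1 : ℕ) : ℤ) = h ∧ ((e 2 : ℕ) : ℤ) = 2 * h := by
    simp [he]
  -- The diagonals ±2h and the antidiagonals 0 and 4h are short; K = 3 allows for even n, where 2h =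
  -- n - 2. In each slanted direction one line has length about n and two about n/2, so the total is
  -- about 3n + 3n + 2n + 2n.
  have hb := card_attackedSquares_le (n := n) (K := 3)
    (Q := (Finset.univ : Finset (Fin 3 × Fin 3)).image fun p => (e p.1, e p.2))
    (R := ({0, (h : ℤ), 2 * (h : ℤ)} : Finset ℤ)) (C := ({0, (h : ℤ), 2 * (h : ℤ)} : Finset ℤ))
    (D := ({0, (h : ℤ), -(h : ℤ)} : Finset ℤ))
    (A := ({(h : ℤ), 2 * (h : ℤ), 3 * (h : ℤ)} : Finset ℤ)) ?_ ?_ ?_ ?_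
  · have h3 : ({0, (h : ℤ), 2 * (h : ℤ)} : Finset ℤ).card ≤ 3 := Finset.card_le_three
    rw [Finset.sum_insert (by simp; omega), Finset.sum_insert (by simp; omega),
      Finset.sum_singleton, Finset.sum_insert (by simp; omega), Finset.sum_insert (by simp; omega),
      Finset.sum_singleton, card_diag, card_diag, card_diag, card_antidiag, card_antidiag,
      card_antidiag, abs_zero, abs_neg, abs_of_nonneg (show (0 : ℤ) ≤ h by omega),
      abs_of_nonpos (show (h : ℤ) - (n - 1) ≤ 0 by omega),
      abs_of_nonpos (show (2 * h : ℤ) - (n - 1) ≤ 0 by omega),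
      abs_of_nonneg (show (0 : ℤ) ≤ 3 * h - (n - 1) by omega)] at hb
    have h4 := Nat.mul_le_mul_right n (Nat.add_le_add h3 h3)
    omega
  all_goals
    intro p hp
    obtain ⟨⟨i, j⟩, -, rfl⟩ := Finset.mem_image.1 hp
    simp only [lineCoord, Finset.mem_insert, Finset.mem_singleton]
    obtain ⟨e0, e1, e2⟩ := he'
  · fin_cases i <;> simp [e0, e1, e2]
  · fin_cases j <;> simp [e0, e1, e2]
  · rw [le_abs]
    fin_cases i <;> fin_cases j <;> simp only [Fin.zero_eta, Fin.mk_one, Fin.reduceFinMk, e0, e1, e2] <;> omega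
  · rw [le_abs]
    fin_cases i <;> fin_cases j <;> simp only [Fin.zero_eta, Fin.mk_one, Fin.reduceFinMk, e0, e1, e2] <;> omega

/-- Placements of `G m` queens that attack few squares. -/
theorem exists_placement {n m : ℕ} (hm : 0 < m) (hn : 2 * m ≤ n) :
    ∃ Q : Finset (Square n), G m ≤ Q.card ∧
      (attackedSquares Q).card ≤ m * n + 16 * m ^ 2 := by
  -- Used with w near m/3 and α, β near m/6, for which w² - α²/2 - β²/2 is about m²/12.
  have corner : ∀ w α β δ : ℕ, w ≤ m → 2 * w + δ = m → 2 * w ≤ 1 + α + β + δ →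
      2 * G m + α * (α + 1) + β * (β + 1) ≤ 2 * w ^ 2 →
      ∃ Q : Finset (Square n), G m ≤ Q.card ∧
        (attackedSquares Q).card ≤ m * n + 16 * m ^ 2 := by
    intro w α β δ hw h1 h2 h3
    obtain ⟨Q, hQ, hQa⟩ := exists_corner_placement (n := n) α β δ (by omega) h2
    have h4 := two_mul_sq_le_card_hexagon w α β
    refine ⟨Q, by omega, hQa.trans ?_⟩
    rw [h1]
    have := Nat.pow_le_pow_left hw 2
    omega
  by_cases h10 : m = 10
  · subst h10
    obtain ⟨Q, hQ, hQa⟩ := exists_nine_placement (n := n) (by omega)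
    exact ⟨Q, by rw [hQ]; rfl, by omega⟩
  by_cases h6 : m % 12 = 6
  · obtain ⟨q, rfl⟩ : ∃ q, m = 12 * q + 6 := ⟨m / 12, by omega⟩
    obtain ⟨Q, hQ, hQa⟩ := exists_four_corner_placement (n := n) q (by omega)
    have h4 := two_mul_sq_le_card_hexagon (2 * q + 1) q q
    refine ⟨Q, ?_, hQa.trans ?_⟩
    · unfold G
      rw [if_pos (by omega), hQ, show (12 * q + 6) ^ 2 = 12 * (12 * q ^ 2 + 12 * q + 3) by ring,
        Nat.mul_div_cancel_left _ (by norm_num)]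
      nlinarith
    · have := Nat.pow_le_pow_left (show 2 * q + 1 ≤ 12 * q + 6 by omega) 2
      omega
  -- m ≡ 3 mod 6 covers the residues 3 and 9 mod 12; with 6 and m = 10 already treated, G is the
  -- plain floor.
  have hG : ∀ z, m % 6 ≠ 3 → m ^ 2 < 12 * z + 12 → G m ≤ z := by
    intro z h1 h2
    unfold G
    rw [if_neg (by omega)]
    omega
  have hcases : m % 6 = 0 ∨ m % 6 = 1 ∨ m % 6 = 2 ∨ m % 6 = 3 ∨ m % 6 = 4 ∨ m % 6 = 5 := by omega
  rcases hcases with h | h | h | h | h | h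
  · obtain ⟨q, rfl⟩ : ∃ q, m = 6 * q + 6 := ⟨m / 6 - 1, by omega⟩
    have := hG (3 * (q + 1) ^ 2) (by omega) (by nlinarith)
    refine corner (2 * q + 2) (q + 1) q (2 * q + 2) (by omega) (by omega) (by omega) ?_
    nlinarith
  · obtain ⟨q, rfl⟩ : ∃ q, m = 6 * q + 1 := ⟨m / 6, by omega⟩
    rcases q with _ | q
    · refine corner 0 0 0 1 (by omega) (by omega) (by omega) ?_
      have := hG 0 (by omega) (by omega)
      omega
    · have := hG (3 * (q + 1) ^ 2 + (q + 1)) (by omega) (by nlinarith)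
      refine corner (2 * q + 2) q q (2 * q + 3) (by omega) (by omega) (by omega) ?_
      nlinarith
  · obtain ⟨q, rfl⟩ : ∃ q, m = 6 * q + 2 := ⟨m / 6, by omega⟩
    have := hG (3 * q ^ 2 + 2 * q) (by omega) (by nlinarith)
    refine corner (2 * q + 1) (q + 1) q (2 * q) (by omega) (by omega) (by omega) ?_
    nlinarith
  · obtain ⟨q, rfl⟩ : ∃ q, m = 6 * q + 3 := ⟨m / 6, by omega⟩
    have : G (6 * q + 3) = 3 * q ^ 2 + 3 * q + 1 := by
      have h1 : (6 * q + 3) ^ 2 = 12 * (3 * q ^ 2 + 3 * q) + 9 := by ring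
      unfold G
      rw [if_pos (by omega)]
      omega
    refine corner (2 * q + 1) q q (2 * q + 1) (by omega) (by omega) (by omega) ?_
    nlinarith
  · obtain ⟨q, rfl⟩ : ∃ q, m = 6 * q + 4 := ⟨m / 6, by omega⟩
    have := hG (3 * q ^ 2 + 4 * q + 1) (by omega) (by nlinarith)
    rcases q with _ | q
    · exact corner 1 0 0 2 (by omega) (by omega) (by omega) (by omega)
    · refine corner (2 * q + 3) (q + 1) q (2 * q + 4) (by omega) (by omega) (by omega) ?_
      nlinarith
  · obtain ⟨q, rfl⟩ : ∃ q, m = 6 * q + 5 := ⟨m / 6, by omega⟩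
    have := hG (3 * q ^ 2 + 5 * q + 2) (by omega) (by nlinarith)
    refine corner (2 * q + 2) (q + 1) (q + 1) (2 * q + 1) (by omega) (by omega) (by omega) ?_
    nlinarith

/-! ### Comparing m² with k and conclusion -/

theorem exists_least_G (k : ℕ) : ∃ m, IsLeast {m : ℕ | 0 < m ∧ k ≤ G m} m := by
  have hne : ({m : ℕ | 0 < m ∧ k ≤ G m}).Nonempty :=
    ⟨12 * k + 1, by omega, le_G_of_le_sq (by nlinarith)⟩
  exact ⟨_, Nat.sInf_mem hne, fun _ h => Nat.sInf_le h⟩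

/-- Minimality of m = j + 1 gives j² < 12k, and m ≤ 2j; this turns O(m²) errors into O(k). -/
theorem sq_le_of_isLeast {k m : ℕ} (hk : 0 < k) (h : IsLeast {m : ℕ | 0 < m ∧ k ≤ G m} m) :
    m ^ 2 ≤ 48 * k := by
  rcases Nat.lt_or_ge m 2 with h1 | h1
  · have := Nat.pow_le_pow_left (show m ≤ 1 by omega) 2
    omega
  · obtain ⟨j, rfl⟩ : ∃ j, m = j + 1 := ⟨m - 1, by omega⟩
    have h2 : j ^ 2 < 12 * k := by
      by_contra hlt
      have := h.2 (show j ∈ {m : ℕ | 0 < m ∧ k ≤ G m} from ⟨by omega, le_G_of_le_sq (by omega)⟩)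
      omega
    nlinarith

theorem theorem1 :
    ∃ c : ℝ, ∀ n k : ℕ, 0 < n → 0 < k → k ≤ n ^ 2 →
      ∃ m : ℕ, IsLeast {m : ℕ | 0 < m ∧ k ≤ G m} m ∧
        ∃ a : ℕ, IsLeast (attackCounts n k) a ∧
          |(a : ℝ) - (m : ℝ) * (n : ℝ)| ≤ c * (k : ℝ) := by
  -- The constant is 16 · 48: both bounds have error 16m², and m² ≤ 48k.
  refine ⟨768, fun n k _ hk hkn => ?_⟩
  obtain ⟨m, hm⟩ := exists_least_G k
  have hmk := sq_le_of_isLeast hk hm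
  have hcard : Fintype.card (Square n) = n ^ 2 := by
    rw [Fintype.card_prod, Fintype.card_fin, pow_two]
  have hne : (attackCounts n k).Nonempty := by
    obtain ⟨Q, -, hQ⟩ := Finset.exists_subset_card_eq
      (show k ≤ (Finset.univ : Finset (Square n)).card by rwa [Finset.card_univ, hcard])
    exact ⟨_, Q, hQ, rfl⟩
  refine ⟨m, hm, sInf (attackCounts n k), ⟨Nat.sInf_mem hne, fun _ h => Nat.sInf_le h⟩, ?_⟩
  obtain ⟨Q, hQ, hQa⟩ := Nat.sInf_mem hne
  have hmin : ∀ b ∈ attackCounts n k, sInf (attackCounts n k) ≤ b := fun _ h => Nat.sInf_le h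
  generalize sInf (attackCounts n k) = a at *
  have hlow : m * n ≤ a + 16 * m ^ 2 := by
    rw [← hQa]
    refine mul_le_card_attackedSquares_add Q fun j hj => hm.2 ⟨?_, hQ ▸ hj⟩
    rcases Nat.eq_zero_or_pos j with rfl | h
    · rw [show G 0 = 0 from rfl] at hj
      omega
    · exact h
  have hupp : a ≤ m * n + 16 * m ^ 2 := by
    -- On a board with n < 2m the whole board has fewer than 4m² squares, so no construction is
    -- needed.
    rcases Nat.lt_or_ge n (2 * m) with h | h
    · have h1 : a ≤ n ^ 2 := by
        rw [← hQa, ← hcard]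
        exact Finset.card_le_univ _
      nlinarith
    · obtain ⟨P, hP, hPa⟩ := exists_placement hm.1.1 h
      obtain ⟨P', hsub, hP'⟩ := Finset.exists_subset_card_eq (hm.1.2.trans hP)
      exact (hmin _ ⟨P', hP', rfl⟩).trans
        ((Finset.card_le_card (attackedSquares_mono hsub)).trans hPa)
  have h1 : (m : ℝ) * n ≤ a + 16 * m ^ 2 := by exact_mod_cast hlow
  have h2 : (a : ℝ) ≤ m * n + 16 * m ^ 2 := by exact_mod_cast hupp
  have h3 : (m : ℝ) ^ 2 ≤ 48 * k := by exact_mod_cast hmk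
  rw [abs_le]
  constructor <;> linarith
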